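/- **Conventions.** $K$ is an abstract elementary class (AEC) in a language $L$: a class of $L$-structures closed under isomorphism, with a partial order $\prec$ on $K$ refining "substructure" and respected by isomorphisms, satisfying coherence (if $M_0\prec M_2$, $M_1\prec M_2$ and $M_0\subseteq M_1$, then $M_0\prec M_1$), the Tarski–Vaught chain axioms (the union $U$ of a $\prec$-increasing continuous chain $\langle M_i: i<\delta\rangle$, $\delta$ limit, is in $K$, each $M_i\prec U$, and $U\prec N$ whenever all $M_i\prec N$), and the Löwenheim–Skolem axiom; $\mathrm{LS}(K)\ge |L|+\aleph_0$ is the least cardinal such that for all $M\in K$ and $A\subseteq |M|$ there is $M_0\prec M$ containing $A$ with $\|M_0\|\le |A|+\mathrm{LS}(K)$. Chains and sequences of ordinals are increasing in the weak sense. Let $\mathcal F=[\lambda,\theta)$, where $\lambda$ is a cardinal and $\theta>\lambda$ is a cardinal or $\infty$, and let $K_{\mathcal F}=\{M\in K:\|M\|\in\mathcal F\}$. A $K$-embedding $f:M\to N$ is an isomorphism of $M$ onto some $f[M]\prec N$. For $n<\omega$, $S^n(M)$ is the set of Galois types $\mathrm{tp}(\bar a/M;N)$ with $M\prec N\in K$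 and $\bar a\in{}^nN$, i.e. the classes of the equivalence relation generated by: $(\bar a,M,N)\sim(\bar b,M,N')$ if there are $N''$ and $K$-embeddings $f:N\to N''$, $g:N'\to N''$ fixing $M$ pointwise with $f(\bar a)=g(\bar b)$. For $p=\mathrm{tp}(\bar a/M;N)\in S^n(M)$, put $\ell(p)=n$; for $m\le n$ and $M_0\prec M$, $p^m\upharpoonright M_0:=\mathrm{tp}(\langle a_i:i<m\rangle/M_0;N)$; and $p$ is nonalgebraic if no $a_i$ lies in $M$. **Frames.** Let $\alpha\le\omega$. A *pre-$(<\alpha,\mathcal F)$-frame* is a triple $\mathfrak s=(K,\perp,S^{bs})$, where $K$ is an AEC with $\mathrm{LS}(K)\le\lambda$ and a model of cardinality $\lambda$; $S^{bs}$ is a set of nonalgebraic types (the *basic* types) of lengths $<\alpha$ over models in $K_{\mathcal F}$; and $\perp$ is a relation on quadruples $(M_0,M_1,\bar a,N)$ with $M_0\prec M_1\prec N$ in $K_{\mathcal F}$ and $\bar a$ a sequence from $N$ of length $<\alpha$, such that: - *Invariance:* if $f:N\cong N'$, then $\perp(M_0,M_1,\bar a,N)$ implies $\perp(f[M_0],f[M_1],f(\bar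 a),N')$, and $\mathrm{tp}(\bar a/M_1;N)\in S^{bs}$ implies $\mathrm{tp}(f(\bar a)/f[M_1];N')\in S^{bs}$. - *Monotonicity:* if $\perp(M_0,M_1,\bar a,N)$, $\bar a'$ is a subsequence of $\bar a$, $M_0\prec M_0'\prec M_1'\prec M_1\prec N'\prec N\prec N''\in K_{\mathcal F}$ and $\bar a'\in N'$, then $\perp(M_0',M_1',\bar a',N')$ and $\perp(M_0',M_1',\bar a',N'')$; and if $\mathrm{tp}(\bar a/M_1;N)\in S^{bs}$, then $\mathrm{tp}(\bar a'/M_1;N)\in S^{bs}$ for every subsequence $\bar a'$ of $\bar a$. - *Nonforking types are basic:* $\perp(M,M,\bar a,N)$ implies $\mathrm{tp}(\bar a/M;N)\in S^{bs}$. A type $p$ over $M_1$ *does not fork over* $M_0$ if $\perp(M_0,M_1,\bar a,N)$ for some $\bar a,N$ with $p=\mathrm{tp}(\bar a/M_1;N)$. A *good $(<\alpha,\mathcal F)$-frame* is a pre-$(<\alpha,\mathcal F)$-frame such that: 1. $K_{\mathcal F}$ has amalgamation, joint embedding and no maximal models. 2. *bs-stability:* there are at most $\|M\|$ basic types of length $1$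 over $M$, for all $M\in K_{\mathcal F}$. 3. *Density:* if $M\prec N$ are in $K_{\mathcal F}$ and $M\ne N$, some $a\in N$ has $\mathrm{tp}(a/M;N)\in S^{bs}$. 4. *Existence:* if $p\in S^{bs}$ is over $M$, $M\prec N\in K_{\mathcal F}$ and $\ell(p)\le\beta<\alpha$, there is a basic $q$ over $N$ of length $\beta$ that does not fork over $M$ with $q^{\ell(p)}\upharpoonright M=p$. 5. *Uniqueness:* if $p,q\in S^{n}(N)$, $n<\alpha$, do not fork over $M$ and $p\upharpoonright M=q\upharpoonright M$, then $p=q$. 6. *Symmetry:* if $\perp(M_0,M_2,\bar a_1,N)$, $\bar a_2$ is a sequence from $M_2$ of length $<\alpha$ and $\mathrm{tp}(\bar a_2/M_0;N)\in S^{bs}$, then there are $M_1$ containing $\bar a_1$ and $N'\succ N$ with $\perp(M_0,M_1,\bar a_2,N')$. 7. *Local character:* if $\delta$ is a limit ordinal, $\langle M_i\in K_{\mathcal F}:i\le\delta\rangle$ is increasing continuous, and $p\in S^{bs}$ is over $M_\delta$ with $\ell(p)<\mathrm{cf}(\delta)$, then $p$ does not fork over $M_i$ for some $i<\delta$. 8.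 *Continuity:* if $\delta$ is a limit ordinal, $\langle M_i\in K_{\mathcal F}:i\le\delta\rangle$ and $\langle\alpha_i<\alpha:i\le\delta\rangle$ are increasing continuous, and $p_i$ ($i<\delta$) is a basic type over $M_i$ of length $\alpha_i$ with $p_j=p_i^{\alpha_j}\upharpoonright M_j$ for $j<i<\delta$, then there is a basic $p$ over $M_\delta$ of length $\alpha_\delta$ with $p_i=p^{\alpha_i}\upharpoonright M_i$ for all $i<\delta$ and such that, if no $p_i$ forks over $M_0$, then $p$ does not fork over $M_0$. 9. *Transitivity:* if $M_0\prec M_1\prec M_2$, $p$ is a type over $M_2$ of length $<\alpha$ that does not fork over $M_1$, and $p\upharpoonright M_1$ does not fork over $M_0$, then $p$ does not fork over $M_0$. It is *good except bs-stability* if all of this holds except possibly 2. A good $\mathcal F$-frame (with no length mentioned) is a good $(<2,\mathcal F)$-frame, i.e. one for sequences of length at most $1$; similarly for good except bs-stability. **Elongation.** Let $\mathfrak s$ be a frame for sequences of length at most $1$. For $n<\omega$, a sequence $\bar a=\langle a_i:i<n\rangle$ from $N$ is *independent from $M_0$ over $M$ in $N$* if $M\prec M_0\prec N$ and there are $N^+\succ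 N$ and models $M_0\prec M_1\prec\dots\prec M_n\prec N^+$, with $M$ and all $M_i$ in $K_{\mathcal F}$, such that $\perp(M,M_i,a_i,M_{i+1})$ for all $i<n$. The elongation $\mathfrak s^{<\omega}=(K,\perp^{<\omega},S^{bs,<\omega})$ is given by: for $M_0\prec M_1\prec N$ in $K_{\mathcal F}$ and a finite sequence $\bar a$ from $N$, $\perp^{<\omega}(M_0,M_1,\bar a,N)$ iff $\bar a$ is independent from $M_1$ over $M_0$ in $N$; and for $M\in K_{\mathcal F}$, a type $p$ over $M$ of finite length is in $S^{bs,<\omega}$ iff $p=\mathrm{tp}(\bar a/M;N)$ for some $N$ and $\bar a$ with $\perp^{<\omega}(M,M,\bar a,N)$. **Corollary 4.6** (solution of Shelah's Exercise III.9.4.1). If $\mathfrak s$ is a good $\mathcal F$-frame, then $\mathfrak s^{<\omega}$ is a good $(<\omega,\mathcal F)$-frame. If $\mathfrak s$ is good except bs-stability, then $\mathfrak s^{<\omega}$ is a $(<\omega,\mathcal F)$-frame that is good except bs-stability. (In both cases this includes symmetry.) -/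

import Mathlib

universe u

namespace GoodFrame

open FirstOrder Cardinal

section Structures

variable {L : FirstOrder.Language.{u, u}}

/-- An `L`-structure in the sense of set theory: its universe is a set of sets. Working with
structures on honest sets lets `M ⊆ N`, unions of chains and "the same element of two models"
have their literal meaning. -/
structure Model (L : FirstOrder.Language.{u, u}) where
  carrier : Set ZFSet.{u}
  small : Small.{u} carrier
  str : L.Structure carrier

attribute [instance] Model.small Model.str

/-- The cardinality `‖M‖`. -/
noncomputable def Model.size (M : Model L) : Cardinal.{u} := #(Shrink.{u} M.carrier)

/-- `f` restricts to an isomorphism of `M` onto `N`. Maps between models are restrictions of maps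
defined everywhere; only the values on `M` matter. In particular `N` is the structure `f[M]`. -/
def IsIso (f : ZFSet.{u} → ZFSet.{u}) (M N : Model L) : Prop :=
  ∃ e : M.carrier ≃[L] N.carrier, ∀ x, (e x : ZFSet.{u}) = f x

/-- `M` is a substructure of `N`: the universe of `M` is contained in that of `N` and the inclusion
is an embedding of `L`-structures. -/
def Model.IsSubstructure (M N : Model L) : Prop :=
  ∃ e : M.carrier ↪[L] N.carrier, ∀ x, (e x : ZFSet.{u}) = x

/-- The structure `U` is the union of the structures `M i`, `i < δ`. -/
def IsUnion (M : Ordinal.{u} → Model L) (δ : Ordinal.{u}) (U : Model L) : Prop :=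
  U.carrier = {x | ∃ i < δ, x ∈ (M i).carrier} ∧ ∀ i < δ, (M i).IsSubstructure U

/-- `⟨M i : i < δ⟩` is increasing (not necessarily strictly) with respect to the relation `r`, and
continuous: unions are taken at limits. The values `M i` for `i ≥ δ` are irrelevant. -/
def IncreasingContinuous (r : Model L → Model L → Prop) (δ : Ordinal.{u})
    (M : Ordinal.{u} → Model L) : Prop :=
  (∀ i j, i ≤ j → j < δ → r (M i) (M j)) ∧
    ∀ i < δ, Order.IsSuccLimit i → IsUnion M i (M i)

end Structures

/-- The cardinal `κ` satisfies the downward Löwenheim-Skolem axiom for the class `Mem` with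
the ordering `Prec`. -/
def LowenheimSkolem {L : FirstOrder.Language.{u, u}} (Mem : Model L → Prop)
    (Prec : Model L → Model L → Prop) (κ : Cardinal.{u}) : Prop :=
  ℵ₀ ≤ κ ∧ L.card ≤ κ ∧ ∀ M, Mem M → ∀ A ⊆ M.carrier, ∃ M₀, Prec M₀ M ∧ A ⊆ M₀.carrier ∧
    Cardinal.lift.{u + 1} M₀.size ≤ #A + Cardinal.lift.{u + 1} κ

/-- An abstract elementary class: a class `Mem` of `L`-structures with a partial order
`Prec` (written `M ≺ N`) on it. -/
structure AEC (L : FirstOrder.Language.{u, u}) where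
  Mem : Model L → Prop
  Prec : Model L → Model L → Prop
  mem_of_prec : ∀ {M N}, Prec M N → Mem M ∧ Mem N
  refl : ∀ {M}, Mem M → Prec M M
  trans : ∀ {M₀ M₁ M₂}, Prec M₀ M₁ → Prec M₁ M₂ → Prec M₀ M₂
  isSubstructure : ∀ {M N}, Prec M N → M.IsSubstructure N
  mem_iso : ∀ {f M M'}, Mem M → IsIso f M M' → Mem M'
  prec_iso : ∀ {f M N M' N'}, Prec M N → IsIso f M M' → IsIso f N N' → Prec M' N'
  coherence : ∀ {M₀ M₁ M₂}, Prec M₀ M₂ → Prec M₁ M₂ → M₀.IsSubstructure M₁ → Prec M₀ M₁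
  chain : ∀ {δ : Ordinal.{u}} {M : Ordinal.{u} → Model L} {U : Model L}, Order.IsSuccLimit δ →
    IncreasingContinuous Prec δ M → IsUnion M δ U →
      Mem U ∧ (∀ i < δ, Prec (M i) U) ∧ ∀ N, (∀ i < δ, Prec (M i) N) → Prec U N
  exists_lowenheimSkolem : ∃ κ : Cardinal.{u}, LowenheimSkolem Mem Prec κ

section Types

variable {L : FirstOrder.Language.{u, u}} (K : AEC L)

/-- The Löwenheim-Skolem number `LS(K)`: the least cardinal `≥ |L| + ℵ₀` for which the downward
Löwenheim-Skolem axiom holds. -/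
noncomputable def AEC.LS : Cardinal.{u} := sInf {κ | LowenheimSkolem K.Mem K.Prec κ}

/-- `M ∈ K_𝓕` for the interval of cardinals `𝓕 = [lam, th)`, where `th = ⊤` stands for `∞`. -/
def AEC.InF (lam : Cardinal.{u}) (th : WithTop Cardinal.{u}) (M : Model L) : Prop :=
  K.Mem M ∧ lam ≤ M.size ∧ (M.size : WithTop Cardinal.{u}) < th

/-- `f : M → N` is a `K`-embedding, i.e. `f : M ≅ f[M] ≺ N`. -/
def AEC.IsEmb (f : ZFSet.{u} → ZFSet.{u}) (M N : Model L) : Prop :=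
  ∃ R, IsIso f M R ∧ K.Prec R N

/-- A triple `(ā, M, N)` with `M ≺ N` and `ā` a finite sequence of length `n` from `N`. -/
structure Realization (M : Model L) (n : ℕ) where
  ambient : Model L
  prec : K.Prec M ambient
  tuple : Fin n → ZFSet.{u}
  mem : ∀ i, tuple i ∈ ambient.carrier

variable {K}

/-- The ambient models of the two triples can be `K`-embedded over `M` into one model so that the
two sequences become equal. -/
def Realization.AtomicEq {M : Model L} {n : ℕ} (p q : Realization K M n) : Prop :=
  ∃ (N : Model L) (f g : ZFSet.{u} → ZFSet.{u}),
    K.IsEmb f p.ambient N ∧ K.IsEmb g q.ambient N ∧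
    (∀ x ∈ M.carrier, f x = x ∧ g x = x) ∧ ∀ i, f (p.tuple i) = g (q.tuple i)

variable (K) in
/-- `S^n(M)`: Galois types over `M` of sequences of finite length `n`, that is, classes of the
equivalence relation generated by `AtomicEq`. -/
def GType (M : Model L) (n : ℕ) : Type (u + 1) :=
  Quot (Realization.AtomicEq (K := K) (M := M) (n := n))

/-- `tp(ā / M; N)`. -/
def tp {M N : Model L} {n : ℕ} {a : Fin n → ZFSet.{u}} (h : K.Prec M N)
    (ha : ∀ i, a i ∈ N.carrier) : GType K M n :=
  Quot.mk _ ⟨N, h, a, ha⟩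

/-- `p^m ↾ M₀`: the restriction of `p ∈ S^n(M)` to the first `m ≤ n` coordinates and to `M₀ ≺ M`. -/
def GType.restrict {M₀ M : Model L} {m n : ℕ} (p : GType K M n) (hM : K.Prec M₀ M) (hm : m ≤ n) :
    GType K M₀ m :=
  Quot.map
    (fun r : Realization K M n =>
      (⟨r.ambient, K.trans hM r.prec, fun i => r.tuple (Fin.castLE hm i), fun i => r.mem _⟩ :
        Realization K M₀ m))
    (fun _ _ ⟨N, f, g, hf, hg, hfg, hi⟩ =>
      ⟨N, f, g, hf, hg,
        fun x hx => hfg x (by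
          obtain ⟨e, he⟩ := K.isSubstructure hM
          have hex := (e ⟨x, hx⟩).2
          rwa [he] at hex),
        fun i => hi _⟩) p

/-- `q ∈ S^n(N)` extends `p ∈ S^m(M)`: `M ≺ N`, `m ≤ n` and `q^m ↾ M = p`. -/
def GType.Extends {M N : Model L} {m n : ℕ} (q : GType K N n) (p : GType K M m) : Prop :=
  ∃ (hM : K.Prec M N) (hm : m ≤ n), q.restrict hM hm = p

/-- The type of a sequence none of whose members lies in the domain `M`. -/
def GType.Nonalgebraic {M : Model L} {n : ℕ} (p : GType K M n) : Prop :=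
  ∃ r : Realization K M n, Quot.mk _ r = p ∧ ∀ i, r.tuple i ∉ M.carrier

end Types

section Frames

variable {L : FirstOrder.Language.{u, u}} {K : AEC L}

variable (K) in
/-- The data `(K, ⫝, S^bs)` of a frame for finite sequences: `nf M₀ M₁ a N` is the nonforking
relation "`a` does not fork from `M₁` over `M₀` inside `N`" and `bs M n` is the set of basic types
of length `n` over `M`. The axioms come afterwards. -/
structure FrameTriple where
  nf : ∀ (_ _ : Model L) {n : ℕ} (_ : Fin n → ZFSet.{u}) (_ : Model L), Prop
  bs : ∀ (M : Model L) (n : ℕ), Set (GType K M n)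

/-- `tp(a / M; N) ∈ S^bs(M)`. -/
def FrameTriple.Basic (s : FrameTriple K) (M : Model L) {n : ℕ} (a : Fin n → ZFSet.{u})
    (N : Model L) : Prop :=
  ∃ (h : K.Prec M N) (ha : ∀ i, a i ∈ N.carrier), tp h ha ∈ s.bs M n

/-- The type `p` over `M₁` does not fork over `M₀`. -/
def FrameTriple.DoesNotFork (s : FrameTriple K) {M₁ : Model L} {n : ℕ} (p : GType K M₁ n)
    (M₀ : Model L) : Prop :=
  ∃ (a : Fin n → ZFSet.{u}) (N : Model L) (h : K.Prec M₁ N) (ha : ∀ i, a i ∈ N.carrier),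
    p = tp h ha ∧ s.nf M₀ M₁ a N

/-- `s` is a pre-`(<α, 𝓕)`-frame, where `𝓕 = [lam, th)` and `α ≤ ω` (so `α = ⊤` stands
for `ω`). -/
structure IsPreFrame (α : ℕ∞) (lam : Cardinal.{u}) (th : WithTop Cardinal.{u})
    (s : FrameTriple K) : Prop where
  lt : (lam : WithTop Cardinal.{u}) < th
  ls_le : K.LS ≤ lam
  exists_size_eq : ∃ M, K.Mem M ∧ M.size = lam
  bs_subset : ∀ {M : Model L} {n : ℕ}, ∀ p ∈ s.bs M n,
    K.InF lam th M ∧ (n : ℕ∞) < α ∧ p.Nonalgebraic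
  nf_domain : ∀ {M₀ M₁ N : Model L} {n : ℕ} {a : Fin n → ZFSet.{u}}, s.nf M₀ M₁ a N →
    K.InF lam th M₀ ∧ K.InF lam th M₁ ∧ K.InF lam th N ∧ K.Prec M₀ M₁ ∧ K.Prec M₁ N ∧
      (∀ i, a i ∈ N.carrier) ∧ (n : ℕ∞) < α
  nf_invariance : ∀ {M₀ M₁ N M₀' M₁' N' : Model L} {n : ℕ} {a : Fin n → ZFSet.{u}}
    {f : ZFSet.{u} → ZFSet.{u}}, IsIso f N N' → IsIso f M₀ M₀' → IsIso f M₁ M₁' →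
      s.nf M₀ M₁ a N → s.nf M₀' M₁' (fun i => f (a i)) N'
  bs_invariance : ∀ {M N M' N' : Model L} {n : ℕ} {a : Fin n → ZFSet.{u}}
    {f : ZFSet.{u} → ZFSet.{u}}, IsIso f N N' → IsIso f M M' →
      s.Basic M a N → s.Basic M' (fun i => f (a i)) N'
  nf_monotonicity : ∀ {M₀ M₀' M₁' M₁ N' N N'' : Model L} {m n : ℕ} {a : Fin n → ZFSet.{u}}
    (e : Fin m ↪o Fin n), s.nf M₀ M₁ a N →
      K.Prec M₀ M₀' → K.Prec M₀' M₁' → K.Prec M₁' M₁ → K.Prec M₁ N' → K.Prec N' N →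
      K.Prec N N'' → K.InF lam th N'' → (∀ i, a (e i) ∈ N'.carrier) →
        s.nf M₀' M₁' (fun i => a (e i)) N' ∧ s.nf M₀' M₁' (fun i => a (e i)) N''
  bs_monotonicity : ∀ {M N : Model L} {m n : ℕ} {a : Fin n → ZFSet.{u}} (e : Fin m ↪o Fin n),
    s.Basic M a N → s.Basic M (fun i => a (e i)) N
  basic_of_nf : ∀ {M N : Model L} {n : ℕ} {a : Fin n → ZFSet.{u}}, s.nf M M a N → s.Basic M a N

/-- `s` is a pre-`(<α, 𝓕)`-frame that has all the properties of a good `(<α, 𝓕)`-frame, except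
possibly bs-stability. -/
structure IsGoodExceptStability (α : ℕ∞) (lam : Cardinal.{u}) (th : WithTop Cardinal.{u})
    (s : FrameTriple K) : Prop extends IsPreFrame α lam th s where
  amalgamation : ∀ {M₀ M₁ M₂ : Model L}, K.InF lam th M₀ → K.InF lam th M₁ → K.InF lam th M₂ →
    K.Prec M₀ M₁ → K.Prec M₀ M₂ → ∃ (N : Model L) (f₁ f₂ : ZFSet.{u} → ZFSet.{u}),
      K.InF lam th N ∧ K.IsEmb f₁ M₁ N ∧ K.IsEmb f₂ M₂ N ∧
        ∀ x ∈ M₀.carrier, f₁ x = x ∧ f₂ x = x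
  joint_embedding : ∀ {M₁ M₂ : Model L}, K.InF lam th M₁ → K.InF lam th M₂ →
    ∃ (N : Model L) (f₁ f₂ : ZFSet.{u} → ZFSet.{u}),
      K.InF lam th N ∧ K.IsEmb f₁ M₁ N ∧ K.IsEmb f₂ M₂ N
  no_maximal_models : ∀ {M : Model L}, K.InF lam th M →
    ∃ N, K.InF lam th N ∧ K.Prec M N ∧ M ≠ N
  density : ∀ {M N : Model L}, K.InF lam th M → K.InF lam th N → K.Prec M N → M ≠ N →
    ∃ a ∈ N.carrier, s.Basic M ![a] N
  existence : ∀ {M N : Model L} {m k : ℕ}, ∀ p ∈ s.bs M m, K.Prec M N → K.InF lam th N →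
    m ≤ k → (k : ℕ∞) < α → ∃ q ∈ s.bs N k, s.DoesNotFork q M ∧ q.Extends p
  uniqueness : ∀ {M N : Model L} {n : ℕ} (p q : GType K N n) (h : K.Prec M N), (n : ℕ∞) < α →
    s.DoesNotFork p M → s.DoesNotFork q M → p.restrict h le_rfl = q.restrict h le_rfl → p = q
  symmetry : ∀ {M₀ M₂ N : Model L} {m n : ℕ} {a₁ : Fin m → ZFSet.{u}} {a₂ : Fin n → ZFSet.{u}},
    s.nf M₀ M₂ a₁ N → (n : ℕ∞) < α → (∀ i, a₂ i ∈ M₂.carrier) → s.Basic M₀ a₂ N →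
      ∃ M₁ N', (∀ i, a₁ i ∈ M₁.carrier) ∧ K.Prec N N' ∧ s.nf M₀ M₁ a₂ N'
  local_character : ∀ {δ : Ordinal.{u}} {M : Ordinal.{u} → Model L} {n : ℕ},
    Order.IsSuccLimit δ → IncreasingContinuous K.Prec (Order.succ δ) M →
      (∀ i ≤ δ, K.InF lam th (M i)) → ∀ p ∈ s.bs (M δ) n, (n : Cardinal.{u}) < δ.cof →
        ∃ i < δ, s.DoesNotFork p (M i)
  continuity : ∀ {δ : Ordinal.{u}} {M : Ordinal.{u} → Model L} {ℓ : Ordinal.{u} → ℕ},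
    Order.IsSuccLimit δ → IncreasingContinuous K.Prec (Order.succ δ) M →
      (∀ i ≤ δ, K.InF lam th (M i)) → (∀ i ≤ δ, (ℓ i : ℕ∞) < α) →
      (∀ i j, i ≤ j → j ≤ δ → ℓ i ≤ ℓ j) →
      (∀ i ≤ δ, Order.IsSuccLimit i → IsLUB (ℓ '' Set.Iio i) (ℓ i)) →
      ∀ p : ∀ i, i < δ → GType K (M i) (ℓ i), (∀ i hi, p i hi ∈ s.bs (M i) (ℓ i)) →
        (∀ j i (hji : j < i) (hi : i < δ), (p i hi).Extends (p j (hji.trans hi))) →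
          ∃ q ∈ s.bs (M δ) (ℓ δ), (∀ i hi, q.Extends (p i hi)) ∧
            ((∀ i hi, s.DoesNotFork (p i hi) (M 0)) → s.DoesNotFork q (M 0))
  transitivity : ∀ {M₀ M₁ M₂ : Model L} {n : ℕ} (p : GType K M₂ n) (_ : K.Prec M₀ M₁)
    (h : K.Prec M₁ M₂), (n : ℕ∞) < α → s.DoesNotFork p M₁ →
      s.DoesNotFork (p.restrict h le_rfl) M₀ → s.DoesNotFork p M₀

/-- `s` is a good `(<α, 𝓕)`-frame, where `𝓕 = [lam, th)`. -/
structure IsGood (α : ℕ∞) (lam : Cardinal.{u}) (th : WithTop Cardinal.{u})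
    (s : FrameTriple K) : Prop extends IsGoodExceptStability α lam th s where
  bs_stability : ∀ {M : Model L}, K.InF lam th M →
    #(s.bs M 1) ≤ Cardinal.lift.{u + 1} M.size

/-- The sequence `a₀, …, aₙ₋₁` together with the chain `C₀ ≺ ⋯ ≺ Cₙ` is independent in
`(M, M', N)`. A finite chain has no limit indices, so continuity is automatic. -/
def FrameTriple.IndependentChain (s : FrameTriple K) (lam : Cardinal.{u})
    (th : WithTop Cardinal.{u}) {n : ℕ} (a : Fin n → ZFSet.{u}) (C : Fin (n + 1) → Model L)
    (M M' N : Model L) : Prop :=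
  (∀ i j, i ≤ j → K.Prec (C i) (C j)) ∧ (∀ i, K.InF lam th (C i)) ∧
    K.Prec M M' ∧ K.Prec M' (C 0) ∧ K.InF lam th M ∧ K.InF lam th M' ∧
    K.Prec (C (Fin.last n)) N ∧ K.InF lam th N ∧
    ∀ i : Fin n, s.nf M (C i.castSucc) ![a i] (C i.succ)

/-- The sequence `a₀, …, aₙ₋₁` is independent in `(M, M₀, N)`, that is, independent from `M₀` over
`M` in `N`. -/
def FrameTriple.Independent (s : FrameTriple K) (lam : Cardinal.{u}) (th : WithTop Cardinal.{u})
    {n : ℕ} (a : Fin n → ZFSet.{u}) (M M₀ N : Model L) : Prop :=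
  K.Prec M M₀ ∧ K.Prec M₀ N ∧ (∀ i, a i ∈ N.carrier) ∧
    ∃ (C : Fin (n + 1) → Model L) (N₁ : Model L), C 0 = M₀ ∧
      K.Prec (C (Fin.last n)) N₁ ∧ K.Prec N N₁ ∧
      s.IndependentChain lam th a C M (C 0) (C (Fin.last n))

/-- The elongation `s^{<α}` (for `α ≤ ω`): nonforking is being an independent sequence, and a type
is basic if it is realized by a sequence independent from its domain over its domain. -/
def FrameTriple.elongation (s : FrameTriple K) (α : ℕ∞) (lam : Cardinal.{u})
    (th : WithTop Cardinal.{u}) : FrameTriple K where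
  nf M₀ M₁ n a N := (n : ℕ∞) < α ∧ K.InF lam th M₀ ∧ K.InF lam th M₁ ∧ K.InF lam th N ∧
    s.Independent lam th a M₀ M₁ N
  bs M n := {p | (n : ℕ∞) < α ∧ K.InF lam th M ∧
    ∃ (a : Fin n → ZFSet.{u}) (N : Model L) (h : K.Prec M N) (ha : ∀ i, a i ∈ N.carrier),
      p = tp h ha ∧ K.InF lam th N ∧ s.Independent lam th a M M N}

end Frames

end GoodFrame

namespace GoodFrame

open FirstOrder Cardinal

/-! ### Isomorphisms of structures carried by sets, and their extensions. -/

section Isomorphisms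

variable {L : FirstOrder.Language.{u, u}} {M N P : Model L} {f g : ZFSet.{u} → ZFSet.{u}}

/-! Call a finite sequence chained from `M₁` over `M₀` if models rising from `M₁` absorb its entries
one at a time, each entry not forking over `M₀` from the model before it. Up to enlarging the
ambient model this is nonforking in the elongation (`elongation_nf_iff`), so the axioms reduce,
mostly by induction on the length, to those for single elements.

Two facts carry most of the proof. By transitivity for single elements, the base of an independent
sequence can be lowered as soon as it can be lowered for each entry (`chained_trans`). This gives
transitivity, and also local character, where the maximum of finitely many indices is taken.
Moreover, the type over `M₁` of a sequence independent from `M₁` over `M₀` depends only on the types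
over `M₀` of its single entries (`sameType_of_chained`), which gives uniqueness. Existence comes
from adding entries and from extending a chain over a larger model (`exists_chained_extension`).
Symmetry comes from moving single elements past each other (`nf_exchange`), iterated until two whole
sequences have changed places (`chained_exchange`).

For continuity, the lengths are eventually constant, because their supremum is finite. Continuity
and local character of single entries give an index `j` such that no later type forks over `M j`; by
uniqueness the nonforking extension of `p j` to `M δ` is then the required limit. Density and
stability concern length one, where the basic types do not change.

All this needs equality of Galois types to be witnessed by a single amalgam in `K_𝓕`, which follows
from Löwenheim-Skolem and amalgamation (`sameType_of_tp_eq`). -/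

theorem IsIso.refl (M : Model L) : IsIso id M M := ⟨Language.Equiv.refl L _, fun _ => rfl⟩

theorem IsIso.congr (h : IsIso f M N) (hfg : ∀ x ∈ M.carrier, f x = g x) : IsIso g M N := by
  obtain ⟨e, he⟩ := h
  exact ⟨e, fun x => (he x).trans (hfg x x.2)⟩

theorem IsIso.of_fixed (h : ∀ x ∈ M.carrier, f x = x) : IsIso f M M :=
  (IsIso.refl M).congr fun x hx => (h x hx).symm

theorem IsIso.comp (hg : IsIso g N P) (hf : IsIso f M N) : IsIso (fun x => g (f x)) M P := by
  obtain ⟨e, he⟩ := hf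
  obtain ⟨e', he'⟩ := hg
  exact ⟨e'.comp e, fun x => by simp [he', he]⟩

theorem IsIso.mem (h : IsIso f M N) {x : ZFSet.{u}} (hx : x ∈ M.carrier) : f x ∈ N.carrier := by
  obtain ⟨e, he⟩ := h
  rw [← he ⟨x, hx⟩]
  exact (e _).2

theorem IsIso.injOn (h : IsIso f M N) : Set.InjOn f M.carrier := by
  obtain ⟨e, he⟩ := h
  intro x hx y hy hxy
  have : e ⟨x, hx⟩ = e ⟨y, hy⟩ := Subtype.ext (by rw [he, he]; exact hxy)
  simpa using this

theorem IsIso.exists_symm (h : IsIso f M N) :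
    ∃ g, IsIso g N M ∧ (∀ x ∈ M.carrier, g (f x) = x) ∧ ∀ y ∈ N.carrier, f (g y) = y := by
  classical
  obtain ⟨e, he⟩ := h
  refine ⟨fun y => if hy : y ∈ N.carrier then e.symm ⟨y, hy⟩ else y,
    ⟨e.symm, fun y => by simp⟩, fun x hx => ?_, fun y hy => ?_⟩
  · have : f x = e ⟨x, hx⟩ := (he ⟨x, hx⟩).symm
    simp [this]
  · simp only [hy, dite_true]
    rw [← he]
    simp

theorem exists_isIso_of_injOn (M : Model L) (hf : Set.InjOn f M.carrier) :
    ∃ N, IsIso f M N := by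
  let e : M.carrier ≃ f '' M.carrier := Equiv.Set.imageOfInjOn f M.carrier hf
  let i : L.Structure (f '' M.carrier) := e.inducedStructure
  exact ⟨⟨f '' M.carrier, small_image f M.carrier, i⟩, e.inducedStructureEquiv, fun _ => rfl⟩

theorem IsIso.size_eq (h : IsIso f M N) : M.size = N.size := by
  obtain ⟨e, -⟩ := h
  exact Cardinal.mk_congr ((equivShrink _).symm.trans (e.toEquiv.trans (equivShrink _)))

/-- A map that sends the elements of a set to elements outside a small class. -/
theorem exists_injective_forall_notMem (A : Set ZFSet.{u}) [Small.{u} A] :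
    ∃ f : ZFSet.{u} → ZFSet.{u}, Function.Injective f ∧ ∀ x, f x ∉ A := by
  let w : ZFSet.{u} := ZFSet.range (fun x : Shrink.{u} A => ((equivShrink A).symm x : ZFSet.{u}))
  refine ⟨fun x => ZFSet.pair x w, fun x y h => (ZFSet.pair_inj.1 h).1, fun x hx => ?_⟩
  -- The set `w` has exactly the elements of `A`, while the pair has larger rank than its component
  -- `w`, so membership would contradict foundation.
  have h1 : ZFSet.pair x w ∈ w := ZFSet.mem_range.2 ⟨equivShrink A ⟨_, hx⟩, by simp⟩
  have h2 : w.rank < ({x, w} : ZFSet).rank := ZFSet.rank_lt_of_mem (by simp)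
  have h3 : ({x, w} : ZFSet).rank < (ZFSet.pair x w).rank :=
    ZFSet.rank_lt_of_mem (by simp [ZFSet.pair])
  exact lt_irrefl _ ((h2.trans h3).trans (ZFSet.rank_lt_of_mem h1))

/-- Elements outside `M` are sent outside `N`, so the extended map stays injective and the structure
of `P` can be transported along it. -/
theorem IsIso.exists_extend (h : IsIso f M N) (P : Model L) :
    ∃ (g : ZFSet.{u} → ZFSet.{u}) (Q : Model L), IsIso g P Q ∧ ∀ x ∈ M.carrier, g x = f x := by
  classical
  obtain ⟨φ, hφ, hφN⟩ := exists_injective_forall_notMem N.carrier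
  let g : ZFSet.{u} → ZFSet.{u} := fun x => if x ∈ M.carrier then f x else φ x
  have hg : Set.InjOn g P.carrier := by
    intro x _ y _ hxy
    by_cases hx : x ∈ M.carrier <;> by_cases hy : y ∈ M.carrier
    · simp only [g, hx, hy, if_true] at hxy
      exact h.injOn hx hy hxy
    · simp only [g, hx, hy, if_true, if_false] at hxy
      exact absurd (hxy ▸ h.mem hx) (hφN y)
    · simp only [g, hx, hy, if_true, if_false] at hxy
      exact absurd (hxy ▸ h.mem hy) (hφN x)
    · simp only [g, hx, hy, if_false] at hxy
      exact hφ hxy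
  obtain ⟨Q, hQ⟩ := exists_isIso_of_injOn P hg
  exact ⟨g, Q, hQ, fun x hx => by simp [g, hx]⟩

theorem Model.IsSubstructure.subset (h : M.IsSubstructure N) : M.carrier ⊆ N.carrier := by
  obtain ⟨e, he⟩ := h
  intro x hx
  rw [← show (e ⟨x, hx⟩ : ZFSet.{u}) = x from he ⟨x, hx⟩]
  exact (e _).2

theorem Model.IsSubstructure.of_subset (hM : M.IsSubstructure P) (hN : N.IsSubstructure P)
    (h : M.carrier ⊆ N.carrier) : M.IsSubstructure N := by
  obtain ⟨e, he⟩ := hM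
  obtain ⟨e', he'⟩ := hN
  have key : ∀ x : M.carrier, e' (Set.inclusion h x) = e x := fun x =>
    Subtype.ext (by rw [he', he])
  have key' : ∀ {n : ℕ} (x : Fin n → M.carrier), e' ∘ (Set.inclusion h ∘ x) = e ∘ x :=
    fun x => funext fun i => key (x i)
  refine ⟨⟨⟨Set.inclusion h, Set.inclusion_injective h⟩, fun F x => ?_, fun R x => ?_⟩,
    fun _ => rfl⟩
  · apply e'.injective
    rw [e'.map_fun]
    exact (key _).trans ((e.map_fun F x).trans (congrArg _ (key' x).symm))
  · change Language.Structure.RelMap R (Set.inclusion h ∘ x) ↔ _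
    rw [← e'.map_rel, ← e.map_rel, key']

end Isomorphisms

/-! ### Embeddings and submodels in `K_𝓕`. -/

namespace AEC

variable {L : FirstOrder.Language.{u, u}} {K : AEC L} {M M' N N' P Q : Model L}
  {f g : ZFSet.{u} → ZFSet.{u}} {lam : Cardinal.{u}} {th : WithTop Cardinal.{u}}

theorem Prec.subset (h : K.Prec M N) : M.carrier ⊆ N.carrier := (K.isSubstructure h).subset

theorem Prec.of_subset (hM : K.Prec M P) (hN : K.Prec N P) (h : M.carrier ⊆ N.carrier) :
    K.Prec M N :=
  K.coherence hM hN ((K.isSubstructure hM).of_subset (K.isSubstructure hN) h)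

theorem Prec.exists_image (h : K.Prec M N) (hf : IsIso f N N') :
    ∃ M', IsIso f M M' ∧ K.Prec M' N' := by
  obtain ⟨M', hM'⟩ := exists_isIso_of_injOn M (hf.injOn.mono (Prec.subset h))
  exact ⟨M', hM', K.prec_iso h hM' hf⟩

theorem Prec.exists_extend (h : K.Prec M N) (hf : IsIso f M M') :
    ∃ g N', IsIso g N N' ∧ K.Prec M' N' ∧ ∀ x ∈ M.carrier, g x = f x := by
  obtain ⟨g, N', hg, hgf⟩ := hf.exists_extend N
  exact ⟨g, N', hg, K.prec_iso h (hf.congr fun x hx => (hgf x hx).symm) hg, hgf⟩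

theorem IsEmb.of_prec (h : K.Prec M N) : K.IsEmb id M N := ⟨M, IsIso.refl M, h⟩

theorem IsEmb.of_isIso (h : IsIso f M N) (hN : K.Mem N) : K.IsEmb f M N := ⟨N, h, K.refl hN⟩

theorem IsEmb.mem (h : K.IsEmb f M N) {x : ZFSet.{u}} (hx : x ∈ M.carrier) : f x ∈ N.carrier := by
  obtain ⟨R, hR, hRN⟩ := h
  exact Prec.subset hRN (hR.mem hx)

theorem IsEmb.injOn (h : K.IsEmb f M N) : Set.InjOn f M.carrier := by
  obtain ⟨R, hR, hRN⟩ := h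
  exact hR.injOn

theorem IsEmb.comp (hg : K.IsEmb g N P) (hf : K.IsEmb f M N) :
    K.IsEmb (fun x => g (f x)) M P := by
  obtain ⟨R, hR, hRN⟩ := hf
  obtain ⟨S, hS, hSP⟩ := hg
  obtain ⟨R', hR', hRS⟩ := Prec.exists_image hRN hS
  exact ⟨R', hR'.comp hR, K.trans hRS hSP⟩

theorem IsEmb.trans_prec (hf : K.IsEmb f M N) (h : K.Prec N P) : K.IsEmb f M P := by
  obtain ⟨R, hR, hRN⟩ := hf
  exact ⟨R, hR, K.trans hRN h⟩

theorem IsEmb.restrict (hf : K.IsEmb f N P) (h : K.Prec M N) : K.IsEmb f M P := by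
  obtain ⟨R, hR, hRN⟩ := hf
  obtain ⟨R', hR', hRS⟩ := Prec.exists_image h hR
  exact ⟨R', hR', K.trans hRS hRN⟩

/-- An embedding becomes an inclusion after its target is replaced by an isomorphic copy. -/
theorem IsEmb.exists_prec (hf : K.IsEmb f M N) :
    ∃ g N', IsIso g N N' ∧ K.Prec M N' ∧ ∀ x ∈ M.carrier, g (f x) = x := by
  obtain ⟨R, hR, hRN⟩ := hf
  obtain ⟨k, hk, hkf, -⟩ := hR.exists_symm
  obtain ⟨g, N', hg, hN', hgk⟩ := Prec.exists_extend hRN hk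
  exact ⟨g, N', hg, hN', fun x hx => (hgk _ (hR.mem hx)).trans (hkf x hx)⟩

theorem InF.of_isIso (hM : K.InF lam th M) (h : IsIso f M N) : K.InF lam th N :=
  ⟨K.mem_iso hM.1 h, h.size_eq ▸ hM.2.1, h.size_eq ▸ hM.2.2⟩

theorem lift_size (M : Model L) : Cardinal.lift.{u + 1} M.size = #M.carrier := by
  simpa [Model.size] using Cardinal.lift_id'.{u, u + 1} _

theorem Prec.size_le (h : K.Prec M N) : M.size ≤ N.size := by
  rw [← Cardinal.lift_le.{u + 1}, lift_size, lift_size]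
  exact Cardinal.mk_le_mk_of_subset (Prec.subset h)

theorem InF.of_between (hM : K.InF lam th M) (hP : K.InF lam th P) (hMN : K.Prec M N)
    (hNP : K.Prec N P) : K.InF lam th N :=
  ⟨(K.mem_of_prec hMN).2, hM.2.1.trans (Prec.size_le hMN),
    (WithTop.coe_le_coe.2 (Prec.size_le hNP)).trans_lt hP.2.2⟩

theorem lowenheimSkolem_LS (K : AEC L) : LowenheimSkolem K.Mem K.Prec K.LS :=
  csInf_mem (s := {κ | LowenheimSkolem K.Mem K.Prec κ}) K.exists_lowenheimSkolem

theorem InF.infinite (hM : K.InF lam th M) (hLS : K.LS ≤ lam) : ℵ₀ ≤ M.size :=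
  K.lowenheimSkolem_LS.1.trans (hLS.trans hM.2.1)

/-- Subsets of a model that contain a model in `K_𝓕` and are not larger than some model in `K_𝓕`
are contained in a submodel in `K_𝓕`. -/
theorem InF.exists_prec (hLS : K.LS ≤ lam) (hM : K.InF lam th M) (hP : K.InF lam th P)
    (hN : K.Mem N) {A : Set ZFSet.{u}} (hMA : M.carrier ⊆ A) (hAN : A ⊆ N.carrier)
    (hA : #A ≤ #P.carrier) : ∃ N₀, K.InF lam th N₀ ∧ K.Prec N₀ N ∧ A ⊆ N₀.carrier := by
  obtain ⟨N₀, h₁, h₂, h₃⟩ := K.lowenheimSkolem_LS.2.2 N hN A hAN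
  refine ⟨N₀, ⟨(K.mem_of_prec h₁).1, hM.2.1.trans ?_, ?_⟩, h₁, h₂⟩
  · rw [← Cardinal.lift_le.{u + 1}, lift_size, lift_size]
    exact Cardinal.mk_le_mk_of_subset (hMA.trans h₂)
  · refine (WithTop.coe_le_coe.2 ?_).trans_lt hP.2.2
    rw [← Cardinal.lift_le.{u + 1}]
    refine h₃.trans (Cardinal.add_le_of_le ?_ ?_ ?_)
    · simpa using hP.infinite hLS
    · rwa [lift_size]
    · exact Cardinal.lift_le.2 (hLS.trans hP.2.1)

theorem InF.exists_prec_of_tuple (hLS : K.LS ≤ lam) (hM : K.InF lam th M) (hMN : K.Prec M N)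
    {n : ℕ} {a : Fin n → ZFSet.{u}} (ha : ∀ i, a i ∈ N.carrier) :
    ∃ N₀, K.InF lam th N₀ ∧ K.Prec N₀ N ∧ K.Prec M N₀ ∧ ∀ i, a i ∈ N₀.carrier := by
  have hinf : ℵ₀ ≤ #M.carrier := by
    rw [← lift_size]
    simpa using hM.infinite hLS
  obtain ⟨N₀, h₁, h₂, h₃⟩ := hM.exists_prec hLS hM (K.mem_of_prec hMN).2
    (A := M.carrier ∪ Set.range a) Set.subset_union_left
    (Set.union_subset (Prec.subset hMN) (Set.range_subset_iff.2 ha))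
    ((Cardinal.mk_union_le _ _).trans (Cardinal.add_le_of_le hinf le_rfl
      (((Set.finite_range a).lt_aleph0).le.trans hinf)))
  exact ⟨N₀, h₁, h₂, Prec.of_subset hMN h₂ (Set.subset_union_left.trans h₃),
    fun i => h₃ (Or.inr ⟨i, rfl⟩)⟩

theorem InF.exists_prec_of_prec (hLS : K.LS ≤ lam) (hM : K.InF lam th M) (hM' : K.InF lam th M')
    (hMN : K.Prec M N) (hMN' : K.Prec M' N) :
    ∃ N₀, K.InF lam th N₀ ∧ K.Prec N₀ N ∧ K.Prec M N₀ ∧ K.Prec M' N₀ := by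
  -- `P` will be the larger of `M` and `M'`; being infinite, it bounds the size of their union.
  have key : ∀ {P : Model L}, K.InF lam th P → M.size ≤ P.size → M'.size ≤ P.size →
      ∃ N₀, K.InF lam th N₀ ∧ K.Prec N₀ N ∧ K.Prec M N₀ ∧ K.Prec M' N₀ := by
    intro P hP h h'
    obtain ⟨N₀, h₁, h₂, h₃⟩ := hM.exists_prec hLS hP (K.mem_of_prec hMN).2
      (A := M.carrier ∪ M'.carrier) Set.subset_union_left
      (Set.union_subset (Prec.subset hMN) (Prec.subset hMN'))
      ((Cardinal.mk_union_le _ _).trans (Cardinal.add_le_of_le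
        (by rw [← lift_size]; simpa using hP.infinite hLS)
        (by rwa [← lift_size, ← lift_size, Cardinal.lift_le])
        (by rwa [← lift_size, ← lift_size, Cardinal.lift_le])))
    exact ⟨N₀, h₁, h₂, Prec.of_subset hMN h₂ (Set.subset_union_left.trans h₃),
      Prec.of_subset hMN' h₂ (Set.subset_union_right.trans h₃)⟩
  rcases le_total M.size M'.size with h | h
  · exact key hM' h le_rfl
  · exact key hM le_rfl h

end AEC

/-! ### Equality of Galois types within `K_𝓕`, and nonforking as a property of types. -/

section

variable {L : FirstOrder.Language.{u, u}} {K : AEC L} {M M₀ M₁ N N' P : Model L}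
  {f g : ZFSet.{u} → ZFSet.{u}} {lam : Cardinal.{u}} {th : WithTop Cardinal.{u}}
  {s t : FrameTriple K} {α β : ℕ∞} {m n : ℕ} {a b c : Fin n → ZFSet.{u}}

variable (K lam th) in
/-- The tuples `a` from `N` and `b` from `N'` are identified by embeddings of `N` and `N'` over `M`
into a model in `K_𝓕`. -/
def AEC.SameType (M : Model L) (a : Fin n → ZFSet.{u}) (N : Model L) (b : Fin n → ZFSet.{u})
    (N' : Model L) : Prop :=
  ∃ (R : Model L) (f g : ZFSet.{u} → ZFSet.{u}), K.InF lam th R ∧ K.IsEmb f N R ∧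
    K.IsEmb g N' R ∧ (∀ x ∈ M.carrier, f x = x ∧ g x = x) ∧ ∀ i, f (a i) = g (b i)

namespace AEC.SameType

theorem symm (h : K.SameType lam th M a N b N') : K.SameType lam th M b N' a N := by
  obtain ⟨R, f, g, hR, hf, hg, hM, hab⟩ := h
  exact ⟨R, g, f, hR, hg, hf, fun x hx => (hM x hx).symm, fun i => (hab i).symm⟩

theorem of_prec (hN : K.Prec N N') (hN' : K.InF lam th N') (a : Fin n → ZFSet.{u}) :
    K.SameType lam th M a N a N' :=
  ⟨N', id, id, hN', IsEmb.of_prec hN, IsEmb.of_prec (K.refl hN'.1), fun _ _ => ⟨rfl, rfl⟩,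
    fun _ => rfl⟩

theorem comp (h : K.SameType lam th M a N b N') (e : Fin m → Fin n) :
    K.SameType lam th M (fun i => a (e i)) N (fun i => b (e i)) N' := by
  obtain ⟨R, f, g, hR, hf, hg, hM, hab⟩ := h
  exact ⟨R, f, g, hR, hf, hg, hM, fun i => hab _⟩

/-- Replacing the common target by an isomorphic copy turns the first embedding into an inclusion.
Most uses of type equality below take this form. -/
theorem exists_prec (h : K.SameType lam th M a N b N') (hMN : K.Prec M N)
    (ha : ∀ i, a i ∈ N.carrier) :
    ∃ R g, K.InF lam th R ∧ K.Prec N R ∧ K.IsEmb g N' R ∧ (∀ x ∈ M.carrier, g x = x) ∧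
      ∀ i, g (b i) = a i := by
  obtain ⟨R, f, g, hR, hf, hg, hM, hab⟩ := h
  obtain ⟨k, R', hk, hNR', hkf⟩ := hf.exists_prec
  have hR' := hR.of_isIso hk
  refine ⟨R', fun x => k (g x), hR', hNR', (IsEmb.of_isIso hk hR'.1).comp hg, fun x hx => ?_,
    fun i => ?_⟩
  · dsimp only
    rw [(hM x hx).2]
    nth_rw 1 [← (hM x hx).1]
    exact hkf x (Prec.subset hMN hx)
  · dsimp only
    rw [← hab, hkf _ (ha i)]

theorem tp_eq (h : K.SameType lam th M a N b N') (hN : K.Prec M N) (hN' : K.Prec M N')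
    (ha : ∀ i, a i ∈ N.carrier) (hb : ∀ i, b i ∈ N'.carrier) : tp hN ha = tp hN' hb := by
  obtain ⟨R, f, g, -, hf, hg, hM, hab⟩ := h
  exact Quot.sound ⟨R, f, g, hf, hg, hM, hab⟩

end AEC.SameType

theorem tp_eq_of_prec (h : K.Prec M N) (hN : K.Prec N N') (ha : ∀ i, a i ∈ N.carrier)
    (hM' : K.Prec M N') (ha' : ∀ i, a i ∈ N'.carrier) :
    tp h ha = tp hM' ha' :=
  Quot.sound ⟨N', id, id, AEC.IsEmb.of_prec hN, AEC.IsEmb.of_prec (K.refl (K.mem_of_prec hN).2),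
    fun _ _ => ⟨rfl, rfl⟩, fun _ => rfl⟩

open AEC

namespace IsPreFrame

theorem nf_base (hs : IsPreFrame α lam th s) {M₀' M₁' : Model L} (h : s.nf M₀ M₁ a N)
    (h₀ : K.Prec M₀ M₀') (h₁ : K.Prec M₀' M₁') (h₂ : K.Prec M₁' M₁) : s.nf M₀' M₁' a N := by
  obtain ⟨-, -, hN, -, h₃, ha, -⟩ := hs.nf_domain h
  have hr := K.refl hN.1
  exact (hs.nf_monotonicity (RelEmbedding.refl _) h h₀ h₁ h₂ h₃ hr hr hN ha).1

theorem nf_up (hs : IsPreFrame α lam th s) (h : s.nf M₀ M₁ a N) (hN : K.Prec N P)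
    (hP : K.InF lam th P) : s.nf M₀ M₁ a P := by
  obtain ⟨h₀, h₁, hN', h₂, h₃, ha, -⟩ := hs.nf_domain h
  exact (hs.nf_monotonicity (RelEmbedding.refl _) h (K.refl h₀.1) h₂ (K.refl h₁.1) h₃
    (K.refl hN'.1) hN hP ha).2

theorem nf_down (hs : IsPreFrame α lam th s) (h : s.nf M₀ M₁ a P) (hN : K.Prec N P)
    (hMN : K.Prec M₁ N) (ha : ∀ i, a i ∈ N.carrier) : s.nf M₀ M₁ a N := by
  obtain ⟨h₀, h₁, hP, h₂, h₃, -, -⟩ := hs.nf_domain h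
  exact (hs.nf_monotonicity (RelEmbedding.refl _) h (K.refl h₀.1) h₂ (K.refl h₁.1) hMN
    hN (K.refl hP.1) hP ha).1

theorem nf_emb (hs : IsPreFrame α lam th s) (h : s.nf M₀ M₁ a N) (hf : K.IsEmb f N P)
    (hP : K.InF lam th P) (hM : ∀ x ∈ M₁.carrier, f x = x) :
    s.nf M₀ M₁ (fun i => f (a i)) P := by
  obtain ⟨-, -, -, h₂, -⟩ := hs.nf_domain h
  obtain ⟨R, hR, hRP⟩ := hf
  exact hs.nf_up (hs.nf_invariance hR (IsIso.of_fixed fun x hx => hM x (Prec.subset h₂ hx))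
    (IsIso.of_fixed hM) h) hRP hP

theorem nf_of_sameType (hs : IsPreFrame α lam th s) (h : s.nf M₀ M₁ b N')
    (hN : K.Prec M₁ N) (ha : ∀ i, a i ∈ N.carrier) (hab : K.SameType lam th M₁ a N b N') :
    s.nf M₀ M₁ a N := by
  obtain ⟨R, g, hR, hNR, hg, hgM, hgb⟩ := hab.exists_prec hN ha
  have := hs.nf_emb h hg hR hgM
  rw [funext hgb] at this
  exact hs.nf_down this hNR hN ha

end IsPreFrame

namespace IsGoodExceptStability

theorem exists_amalgam (hs : IsGoodExceptStability α lam th s) (hM : K.InF lam th M)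
    (hN : K.InF lam th N) (hP : K.InF lam th P) (hMN : K.Prec M N) (hMP : K.Prec M P) :
    ∃ Q g, K.InF lam th Q ∧ K.Prec N Q ∧ K.IsEmb g P Q ∧ ∀ x ∈ M.carrier, g x = x := by
  obtain ⟨Q₀, f₁, f₂, hQ₀, hf₁, hf₂, hf⟩ := hs.amalgamation hM hN hP hMN hMP
  obtain ⟨k, Q, hk, hNQ, hkf⟩ := hf₁.exists_prec
  have hQ := hQ₀.of_isIso hk
  refine ⟨Q, fun x => k (f₂ x), hQ, hNQ, (IsEmb.of_isIso hk hQ.1).comp hf₂, fun x hx => ?_⟩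
  dsimp only
  rw [(hf x hx).2]
  nth_rw 1 [← (hf x hx).1]
  exact hkf x (Prec.subset hMN hx)

/-- The two common targets are amalgamated over the middle model `N'`. -/
theorem sameType_trans (hs : IsGoodExceptStability α lam th s) {N'' : Model L}
    (hN' : K.InF lam th N') (hMN : K.Prec M N') (hb : ∀ i, b i ∈ N'.carrier)
    (h : K.SameType lam th M a N b N') (h' : K.SameType lam th M b N' c N'') :
    K.SameType lam th M a N c N'' := by
  obtain ⟨R, f, hR, hNR, hf, hfM, hfa⟩ := h.symm.exists_prec hMN hb
  obtain ⟨S, g, hS, hNS, hg, hgM, hgc⟩ := h'.exists_prec hMN hb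
  obtain ⟨Q, k, hQ, hRQ, hk, hkN⟩ := hs.exists_amalgam hN' hR hS hNR hNS
  refine ⟨Q, f, fun x => k (g x), hQ, hf.trans_prec hRQ, hk.comp hg, fun x hx => ⟨hfM x hx, ?_⟩,
    fun i => ?_⟩
  · dsimp only
    rw [hgM x hx, hkN x (Prec.subset hMN hx)]
  · dsimp only
    rw [hfa, hgc, hkN _ (hb i)]

/-- The generated equivalence may pass through ambient models outside `K_𝓕`, where no amalgamation
is available. Each ambient model and each common target is therefore cut down to a submodel in `K_𝓕`
that contains the relevant data. -/
theorem sameType_of_eqvGen (hs : IsGoodExceptStability α lam th s) (hM : K.InF lam th M)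
    {p q : Realization K M n} (h : Relation.EqvGen Realization.AtomicEq p q) :
    ∀ p₀ q₀ : Model L, K.InF lam th p₀ → K.InF lam th q₀ → K.Prec M p₀ → K.Prec M q₀ →
      K.Prec p₀ p.ambient → K.Prec q₀ q.ambient → (∀ i, p.tuple i ∈ p₀.carrier) →
        (∀ i, q.tuple i ∈ q₀.carrier) → K.SameType lam th M p.tuple p₀ q.tuple q₀ := by
  have atomic : ∀ {p q : Realization K M n}, Realization.AtomicEq p q →
      ∀ p₀ q₀ : Model L, K.InF lam th p₀ → K.InF lam th q₀ → K.Prec p₀ p.ambient →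
        K.Prec q₀ q.ambient → K.SameType lam th M p.tuple p₀ q.tuple q₀ := by
    rintro p q ⟨N, f, g, hf, hg, hfg, hi⟩ p₀ q₀ hp₀ hq₀ hp hq
    obtain ⟨R, hR, hRN⟩ := hf.restrict hp
    obtain ⟨S, hS, hSN⟩ := hg.restrict hq
    obtain ⟨N₀, hN₀, -, h₁, h₂⟩ :=
      (hp₀.of_isIso hR).exists_prec_of_prec hs.ls_le (hq₀.of_isIso hS) hRN hSN
    exact ⟨N₀, f, g, hN₀, ⟨R, hR, h₁⟩, ⟨S, hS, h₂⟩, hfg, hi⟩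
  induction h with
  | rel p q h => intro p₀ q₀ hp₀ hq₀ _ _ hp hq _ _; exact atomic h p₀ q₀ hp₀ hq₀ hp hq
  | refl p =>
    intro p₀ q₀ hp₀ hq₀ _ _ hp hq _ _
    have hr := K.refl (K.mem_of_prec p.prec).2
    exact atomic ⟨p.ambient, id, id, IsEmb.of_prec hr, IsEmb.of_prec hr, fun _ _ => ⟨rfl, rfl⟩,
      fun _ => rfl⟩ p₀ q₀ hp₀ hq₀ hp hq
  | symm p q _ ih =>
    intro p₀ q₀ hp₀ hq₀ hMp hMq hp hq hpt hqt
    exact (ih q₀ p₀ hq₀ hp₀ hMq hMp hq hp hqt hpt).symm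
  | trans p q r _ _ ih ih' =>
    intro p₀ r₀ hp₀ hr₀ hMp hMr hp hr hpt hrt
    obtain ⟨q₀, hq₀, hq, hMq, hqt⟩ := hM.exists_prec_of_tuple hs.ls_le q.prec q.mem
    exact hs.sameType_trans hq₀ hMq hqt (ih p₀ q₀ hp₀ hq₀ hMp hMq hp hq hpt hqt)
      (ih' q₀ r₀ hq₀ hr₀ hMq hMr hq hr hqt hrt)

theorem sameType_of_tp_eq (hs : IsGoodExceptStability α lam th s) (hM : K.InF lam th M)
    (hN : K.InF lam th N) (hN' : K.InF lam th N') {h : K.Prec M N} {h' : K.Prec M N'}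
    {ha : ∀ i, a i ∈ N.carrier} {hb : ∀ i, b i ∈ N'.carrier} (heq : tp h ha = tp h' hb) :
    K.SameType lam th M a N b N' :=
  hs.sameType_of_eqvGen hM (Quot.eqvGen_exact heq) N N' hN hN' h h' (K.refl hN.1) (K.refl hN'.1)
    ha hb

/-- Nonforking is a property of Galois types, in any frame over the same class. -/
theorem doesNotFork_tp_iff (hs : IsGoodExceptStability α lam th s) (ht : IsPreFrame β lam th t)
    (hN : K.InF lam th N) {h : K.Prec M₁ N} {ha : ∀ i, a i ∈ N.carrier} :
    t.DoesNotFork (tp h ha) M₀ ↔ t.nf M₀ M₁ a N := by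
  refine ⟨?_, fun hnf => ⟨a, N, h, ha, rfl, hnf⟩⟩
  rintro ⟨b, N', h', hb, heq, hnf⟩
  obtain ⟨-, h₁, hN', -⟩ := ht.nf_domain hnf
  exact ht.nf_of_sameType hnf h ha (hs.sameType_of_tp_eq h₁ hN hN' heq)

theorem nf_trans (hs : IsGoodExceptStability α lam th s) {M₂ : Model L} (h : s.nf M₁ M₂ a N)
    (h' : s.nf M₀ M₁ a N) : s.nf M₀ M₂ a N := by
  obtain ⟨-, h₂, hN, h₁₂, h₃, ha, hn⟩ := hs.nf_domain h
  obtain ⟨-, -, -, h₀₁, h₃', -⟩ := hs.nf_domain h'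
  exact (hs.doesNotFork_tp_iff hs.toIsPreFrame hN (h := h₃) (ha := ha)).1
    (hs.transitivity _ h₀₁ h₁₂ hn ⟨a, N, h₃, ha, rfl, h⟩ ⟨a, N, h₃', ha, rfl, h'⟩)

/-- Nonforking extensions over a larger model, where the ambient model is moved. -/
theorem exists_nf_extension (hs : IsGoodExceptStability α lam th s) {C E : Model L}
    (h : s.nf M₀ C a P) (hCE : K.Prec C E) (hE : K.InF lam th E) :
    ∃ Q g, K.InF lam th Q ∧ K.Prec E Q ∧ K.IsEmb g P Q ∧ (∀ x ∈ C.carrier, g x = x) ∧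
      s.nf M₀ E (fun i => g (a i)) Q := by
  obtain ⟨-, hC, hP, h₀, h₁, ha, hn⟩ := hs.nf_domain h
  obtain ⟨hCP, ha', hbs⟩ := hs.basic_of_nf (hs.nf_base h h₀ (K.refl hC.1) (K.refl hC.1))
  obtain ⟨q, -, ⟨b, R, hER, hb, rfl, hnf⟩, ⟨_, _, hqp⟩⟩ :=
    hs.existence _ hbs hCE hE le_rfl hn
  obtain ⟨-, -, hR, -⟩ := hs.nf_domain hnf
  obtain ⟨Q, g, hQ, hRQ, hg, hgC, hgb⟩ :=
    (hs.sameType_of_tp_eq hC hR hP (h := K.trans hCE hER) (h' := hCP) (ha := hb) (hb := ha') hqp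
      ).exists_prec (K.trans hCE hER) hb
  refine ⟨Q, g, hQ, K.trans hER hRQ, hg, hgC, ?_⟩
  rw [show (fun i => g (a i)) = b from funext hgb]
  -- The extension does not fork over `C`, and its restriction to `C` does not fork over `M₀`.
  refine hs.nf_trans (hs.nf_up hnf hRQ hQ) ?_
  have := hs.nf_emb h hg hQ hgC
  rwa [show (fun i => g (a i)) = b from funext hgb] at this

/-- Nonforking extensions over a larger model, where the larger model is moved. -/
theorem exists_nf_extension' (hs : IsGoodExceptStability α lam th s) {C E : Model L}
    (h : s.nf M₀ C a P) (hCE : K.Prec C E) (hE : K.InF lam th E) :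
    ∃ Q D k, K.InF lam th Q ∧ K.Prec P Q ∧ IsIso k E D ∧ K.Prec D Q ∧
      (∀ x ∈ C.carrier, k x = x) ∧ s.nf M₀ D a Q := by
  obtain ⟨-, -, -, h₀, h₁, ha, -⟩ := hs.nf_domain h
  obtain ⟨Q', g, hQ', hEQ', hg, hgC, hnf⟩ := hs.exists_nf_extension h hCE hE
  obtain ⟨k, Q, hk, hPQ, hkg⟩ := hg.exists_prec
  obtain ⟨D, hD, hDQ⟩ := Prec.exists_image hEQ' hk
  have hkC : ∀ x ∈ C.carrier, k x = x := fun x hx => by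
    nth_rw 1 [← hgC x hx]
    exact hkg x (Prec.subset h₁ hx)
  refine ⟨Q, D, k, hQ'.of_isIso hk, hPQ, hD, hDQ, hkC, ?_⟩
  have := hs.nf_invariance hk
    (IsIso.of_fixed fun x hx => hkC x (Prec.subset h₀ hx)) hD hnf
  rwa [show (fun i => k (g (a i))) = a from funext fun i => hkg _ (ha i)] at this

theorem sameType_of_nf (hs : IsGoodExceptStability α lam th s) (h : s.nf M₀ M₁ a N)
    (h' : s.nf M₀ M₁ b N') (hab : K.SameType lam th M₀ a N b N') :
    K.SameType lam th M₁ a N b N' := by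
  obtain ⟨-, h₁, hN, h₀₁, h₂, ha, hn⟩ := hs.nf_domain h
  obtain ⟨-, -, hN', -, h₂', hb, -⟩ := hs.nf_domain h'
  exact hs.sameType_of_tp_eq h₁ hN hN'
    (hs.uniqueness (tp h₂ ha) (tp h₂' hb) h₀₁ hn ⟨a, N, h₂, ha, rfl, h⟩ ⟨b, N', h₂', hb, rfl, h'⟩
      (hab.tp_eq _ _ _ _))

/-- Existence over `M` itself, with the length unchanged, can only return `p`. -/
theorem doesNotFork_of_mem_bs (hs : IsGoodExceptStability α lam th s) {p : GType K M n}
    (hp : p ∈ s.bs M n) : s.DoesNotFork p M := by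
  obtain ⟨hM, hn, -⟩ := hs.bs_subset p hp
  obtain ⟨q, -, hq, _, _, rfl⟩ := hs.existence p hp (K.refl hM.1) hM le_rfl hn
  have : q.restrict (K.refl hM.1) le_rfl = q := by
    induction q using Quot.ind
    rfl
  rwa [this]

theorem nf_of_basic (hs : IsGoodExceptStability α lam th s) (hN : K.InF lam th N)
    (h : s.Basic M a N) : s.nf M M a N := by
  obtain ⟨h₁, ha, hbs⟩ := h
  exact (hs.doesNotFork_tp_iff hs.toIsPreFrame hN).1 (hs.doesNotFork_of_mem_bs hbs)

/-- Supplies the new entries when an independent sequence is lengthened. -/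
theorem exists_nf (hs : IsGoodExceptStability α lam th s) (hM : K.InF lam th M) :
    ∃ (x : ZFSet.{u}) (N : Model L), s.nf M M ![x] N := by
  obtain ⟨N, hN, hMN, hne⟩ := hs.no_maximal_models hM
  obtain ⟨x, -, hx⟩ := hs.density hM hN hMN hne
  exact ⟨x, N, hs.nf_of_basic hN hx⟩

end IsGoodExceptStability

end

/-! ### Independent finite sequences: extension, uniqueness and exchange. -/

section

open AEC

variable {L : FirstOrder.Language.{u, u}} {K : AEC L} {M M₀ M₁ N N' P : Model L}
  {f g : ZFSet.{u} → ZFSet.{u}} {lam : Cardinal.{u}} {th : WithTop Cardinal.{u}}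
  {s t : FrameTriple K} {α β : ℕ∞} {m n : ℕ} {a b c : Fin n → ZFSet.{u}} {x y : ZFSet.{u}}

theorem comp_singleton (f : ZFSet.{u} → ZFSet.{u}) (x : ZFSet.{u}) :
    (fun i => f ((![x] : Fin 1 → ZFSet.{u}) i)) = ![f x] := by
  ext1 i
  simp

theorem forall_singleton_mem {A : Set ZFSet.{u}} :
    (∀ i, (![x] : Fin 1 → ZFSet.{u}) i ∈ A) ↔ x ∈ A := by
  simp

variable (lam th) in
/-- `a` is independent from `M₁` over `M₀`, by a chain of models below `N`. -/
def FrameTriple.Chained (s : FrameTriple K) : ∀ {n : ℕ} (_ : Fin n → ZFSet.{u})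
    (_ _ _ : Model L), Prop
  | 0, _, M₀, M₁, N => K.InF lam th M₀ ∧ K.InF lam th M₁ ∧ K.InF lam th N ∧ K.Prec M₀ M₁ ∧
      K.Prec M₁ N
  | n + 1, a, M₀, M₁, N => ∃ C, s.Chained (fun i : Fin n => a i.castSucc) M₀ M₁ C ∧
      s.nf M₀ C ![a (Fin.last n)] N

namespace IsPreFrame

variable (hs : IsPreFrame α lam th s)
include hs

theorem chained_domain : ∀ {n : ℕ} {a : Fin n → ZFSet.{u}} {N : Model L},
    s.Chained lam th a M₀ M₁ N → K.InF lam th M₀ ∧ K.InF lam th M₁ ∧ K.InF lam th N ∧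
      K.Prec M₀ M₁ ∧ K.Prec M₁ N ∧ ∀ i, a i ∈ N.carrier
  | 0, _, _, ⟨h₀, h₁, h₂, h₃, h₄⟩ => ⟨h₀, h₁, h₂, h₃, h₄, fun i => i.elim0⟩
  | n + 1, a, N, ⟨C, hC, hnf⟩ => by
    obtain ⟨h₀, h₁, h₂, h₃, h₄, ha⟩ := chained_domain hC
    obtain ⟨-, -, hN, -, hCN, hl, -⟩ := hs.nf_domain hnf
    refine ⟨h₀, h₁, hN, h₃, K.trans h₄ hCN, fun i => ?_⟩
    induction i using Fin.lastCases with
    | last => exact hl 0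
    | cast i => exact Prec.subset hCN (ha i)

theorem chained_up : ∀ {n : ℕ} {a : Fin n → ZFSet.{u}}, s.Chained lam th a M₀ M₁ N →
    K.Prec N P → K.InF lam th P → s.Chained lam th a M₀ M₁ P
  | 0, _, ⟨h₀, h₁, _, h₃, h₄⟩, hNP, hP => ⟨h₀, h₁, hP, h₃, K.trans h₄ hNP⟩
  | _ + 1, _, ⟨C, hC, hnf⟩, hNP, hP => ⟨C, hC, hs.nf_up hnf hNP hP⟩

theorem chained_base {M₀' M₁' : Model L} (h₀ : K.Prec M₀ M₀') (h₁ : K.Prec M₀' M₁')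
    (h₂ : K.Prec M₁' M₁) : ∀ {n : ℕ} {a : Fin n → ZFSet.{u}} {N : Model L},
      s.Chained lam th a M₀ M₁ N → s.Chained lam th a M₀' M₁' N
  | 0, _, _, ⟨h₀', h₁', h₂', _, h₄⟩ =>
    ⟨h₀'.of_between h₁' h₀ (K.trans h₁ h₂), h₀'.of_between h₁' (K.trans h₀ h₁) h₂, h₂', h₁,
      K.trans h₂ h₄⟩
  | _ + 1, _, _, ⟨C, hC, hnf⟩ => by
    obtain ⟨-, -, hC', -, h₄, -⟩ := hs.chained_domain hC
    exact ⟨C, chained_base h₀ h₁ h₂ hC,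
      hs.nf_base hnf h₀ (K.trans h₁ (K.trans h₂ h₄)) (K.refl hC'.1)⟩

theorem chained_iso {M₀' M₁' : Model L} (h₀ : IsIso f M₀ M₀') (h₁ : IsIso f M₁ M₁') :
    ∀ {n : ℕ} {a : Fin n → ZFSet.{u}} {N N' : Model L}, s.Chained lam th a M₀ M₁ N →
      IsIso f N N' → s.Chained lam th (fun i => f (a i)) M₀' M₁' N'
  | 0, _, _, _, ⟨h₀', h₁', h₂', h₃, h₄⟩, hN =>
    ⟨h₀'.of_isIso h₀, h₁'.of_isIso h₁, h₂'.of_isIso hN, K.prec_iso h₃ h₀ h₁, K.prec_iso h₄ h₁ hN⟩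
  | n + 1, a, _, _, ⟨C, hC, hnf⟩, hN => by
    obtain ⟨-, -, -, -, hCN, -⟩ := hs.nf_domain hnf
    obtain ⟨C', hC', -⟩ := Prec.exists_image hCN hN
    refine ⟨C', chained_iso h₀ h₁ hC hC', ?_⟩
    have := hs.nf_invariance hN h₀ hC' hnf
    rwa [comp_singleton] at this

theorem chained_emb (h : s.Chained lam th a M₀ M₁ N) (hf : K.IsEmb f N P)
    (hP : K.InF lam th P) (hM : ∀ x ∈ M₁.carrier, f x = x) :
    s.Chained lam th (fun i => f (a i)) M₀ M₁ P := by
  obtain ⟨-, -, -, h₂, -⟩ := hs.chained_domain h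
  obtain ⟨R, hR, hRP⟩ := hf
  exact hs.chained_up (hs.chained_iso (IsIso.of_fixed fun x hx => hM x (Prec.subset h₂ hx))
    (IsIso.of_fixed hM) h hR) hRP hP

theorem chained_subsequence : ∀ {n : ℕ} {a : Fin n → ZFSet.{u}} {N : Model L},
    s.Chained lam th a M₀ M₁ N → ∀ {m : ℕ} (e : Fin m → Fin n), StrictMono e →
      s.Chained lam th (fun i => a (e i)) M₀ M₁ N
  | _, _, _, h, 0, _, _ => by
    obtain ⟨h₀, h₁, hN, h₂, h₃, -⟩ := hs.chained_domain h
    exact ⟨h₀, h₁, hN, h₂, h₃⟩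
  | 0, _, _, _, _ + 1, e, _ => (e 0).elim0
  | n + 1, a, N, ⟨C, hC, hnf⟩, m + 1, e, he => by
    obtain ⟨-, -, hN, -, hCN, -⟩ := hs.nf_domain hnf
    -- If the subsequence uses the last entry, the last step of the chain is kept; otherwise the
    -- whole subsequence already lies in `C`.
    by_cases hlast : e (Fin.last m) = Fin.last n
    · have hne : ∀ i : Fin m, e i.castSucc ≠ Fin.last n := fun i =>
        (hlast ▸ he (Fin.castSucc_lt_last i)).ne
      refine ⟨C, ?_, by simpa only [hlast] using hnf⟩
      have := chained_subsequence hC (fun i : Fin m => (e i.castSucc).castPred (hne i))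
        fun i j hij => Fin.castPred_lt_castPred_iff.2 (he (Fin.castSucc_lt_castSucc_iff.2 hij))
      simpa using this
    · have hne : ∀ i : Fin (m + 1), e i ≠ Fin.last n := fun i h =>
        hlast (le_antisymm (Fin.le_last _) (h ▸ he.monotone (Fin.le_last i)))
      have := chained_subsequence hC (fun i : Fin (m + 1) => (e i).castPred (hne i))
        fun i j hij => Fin.castPred_lt_castPred_iff.2 (he hij)
      simp only [Fin.castSucc_castPred] at this
      exact hs.chained_up this hCN hN

theorem nf_of_chained : ∀ {n : ℕ} {a : Fin n → ZFSet.{u}} {N : Model L},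
    s.Chained lam th a M₀ M₁ N → ∀ i, s.nf M₀ M₁ ![a i] N
  | 0, _, _, _, i => i.elim0
  | n + 1, a, N, ⟨C, hC, hnf⟩, i => by
    obtain ⟨-, -, hN, -, hCN, -⟩ := hs.nf_domain hnf
    obtain ⟨h₀, h₁, -, h₂, h₃, -⟩ := hs.chained_domain hC
    induction i using Fin.lastCases with
    | last => exact hs.nf_base hnf (K.refl h₀.1) h₂ h₃
    | cast i => exact hs.nf_up (nf_of_chained hC i) hCN hN

theorem chained_one : s.Chained lam th ![x] M₀ M₁ N ↔ s.nf M₀ M₁ ![x] N := by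
  refine ⟨fun h => hs.nf_of_chained h 0, fun h => ?_⟩
  obtain ⟨h₀, h₁, -, h₂, -⟩ := hs.nf_domain h
  exact ⟨M₁, ⟨h₀, h₁, h₁, h₂, K.refl h₁.1⟩, h⟩

end IsPreFrame

namespace IsGoodExceptStability

variable (hs : IsGoodExceptStability α lam th s)
include hs

/-- The same chain serves for the smaller base: at each step nonforking over `M₁` is composed with
nonforking of that entry from `M₁` over `M₀`. -/
theorem chained_trans {M₂ : Model L} : ∀ {n : ℕ} {a : Fin n → ZFSet.{u}} {N : Model L},
    s.Chained lam th a M₁ M₂ N → K.InF lam th M₀ → K.Prec M₀ M₁ →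
      (∀ i, s.nf M₀ M₁ ![a i] N) → s.Chained lam th a M₀ M₂ N
  | 0, _, _, ⟨_, h₁, h₂, h₃, h₄⟩, h₀, h₀₁, _ => ⟨h₀, h₁, h₂, K.trans h₀₁ h₃, h₄⟩
  | n + 1, a, N, ⟨C, hC, hnf⟩, h₀, h₀₁, ha => by
    obtain ⟨-, -, -, -, hCN, -⟩ := hs.nf_domain hnf
    obtain ⟨-, -, -, h₁₂, h₂C, haC⟩ := hs.chained_domain hC
    exact ⟨C, chained_trans hC h₀ h₀₁ fun i =>
      hs.nf_down (ha i.castSucc) hCN (K.trans h₁₂ h₂C) (forall_singleton_mem.2 (haC i)),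
      hs.nf_trans hnf (ha (Fin.last n))⟩

/-- It is `E` that moves and the sequence that stays, so that the entries already handled survive
the later steps of the induction. -/
theorem exists_chained_extension' {C E : Model L} (hCE : K.Prec C E) (hE : K.InF lam th E) :
    ∀ {n : ℕ} {a : Fin n → ZFSet.{u}} {P : Model L}, s.Chained lam th a M₀ C P →
    ∃ Q D k, K.InF lam th Q ∧ K.Prec P Q ∧ IsIso k E D ∧ K.Prec D Q ∧
      (∀ x ∈ C.carrier, k x = x) ∧ s.Chained lam th a M₀ D Q
  | 0, a, P, ⟨h₀, h₁, hP, h₂, h₃⟩ => by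
    obtain ⟨Q, k, hQ, hPQ, ⟨D, hkD, hDQ⟩, hk⟩ := hs.exists_amalgam h₁ hP hE h₃ hCE
    exact ⟨Q, D, k, hQ, hPQ, hkD, hDQ, hk, h₀, hE.of_isIso hkD, hQ,
      K.trans h₂ (K.prec_iso hCE (IsIso.of_fixed hk) hkD), hDQ⟩
  | n + 1, a, P, ⟨C', hC', hnf⟩ => by
    obtain ⟨-, -, -, h₀C, hCC', ha⟩ := hs.chained_domain hC'
    obtain ⟨Q', D', k', hQ', hCQ', hkD', hDQ', hk', hch⟩ := exists_chained_extension' hCE hE hC'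
    -- The last entry must not fork from a model containing the whole extended chain, so all of `Q'`
    -- is moved over `C'`. This fixes the earlier entries, which lie in `C'`.
    obtain ⟨Q, D, k, hQ, hPQ, hkD, hDQ, hk, hnfQ⟩ := hs.exists_nf_extension' hnf hCQ' hQ'
    obtain ⟨E', hkE', hED⟩ := Prec.exists_image hDQ' hkD
    refine ⟨Q, E', _, hQ, hPQ, hkE'.comp hkD', K.trans hED hDQ, fun x hx => ?_, D, ?_, hnfQ⟩
    · rw [hk' x hx, hk x (Prec.subset hCC' hx)]
    · have := hs.chained_iso (IsIso.of_fixed fun x hx =>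
        hk x (Prec.subset hCC' (Prec.subset h₀C hx))) hkE' hch hkD
      rwa [show (fun i : Fin n => k (a i.castSucc)) = fun i => a i.castSucc from
        funext fun i => hk _ (ha i)] at this

theorem exists_chained_extension {C E : Model L} (h : s.Chained lam th a M₀ C P)
    (hCE : K.Prec C E) (hE : K.InF lam th E) :
    ∃ Q g, K.InF lam th Q ∧ K.Prec E Q ∧ K.IsEmb g P Q ∧ (∀ x ∈ C.carrier, g x = x) ∧
      s.Chained lam th (fun i => g (a i)) M₀ E Q := by
  obtain ⟨-, -, -, h₀, h₁, ha⟩ := hs.chained_domain h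
  obtain ⟨Q', D, k, hQ', hPQ', hkD, hDQ', hk, hch⟩ := hs.exists_chained_extension' hCE hE h
  obtain ⟨g, Q, hg, hEQ, hgk⟩ := IsEmb.exists_prec (K := K) ⟨D, hkD, hDQ'⟩
  have hQ := hQ'.of_isIso hg
  have hgC : ∀ x ∈ C.carrier, g x = x := fun x hx => by
    nth_rw 1 [← hk x hx]
    exact hgk x (Prec.subset hCE hx)
  -- On `D` the map `g` is the inverse of `k`.
  have hgD : IsIso g D E := by
    obtain ⟨r, hr, hrk, hkr⟩ := hkD.exists_symm
    refine hr.congr fun y hy => ?_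
    nth_rw 2 [← hkr y hy]
    exact (hgk _ (hr.mem hy)).symm
  exact ⟨Q, g, hQ, hEQ, (IsEmb.of_isIso hg hQ.1).restrict hPQ', hgC,
    hs.chained_iso (IsIso.of_fixed fun x hx => hgC x (Prec.subset h₀ hx)) hgD hch hg⟩

theorem exists_chained_succ (h : s.Chained lam th a M₀ M₁ N) :
    ∃ (c : Fin (n + 1) → ZFSet.{u}) (Q : Model L), K.Prec N Q ∧ (∀ i, c (Fin.castSucc i) = a i) ∧
      s.Chained lam th c M₀ M₁ Q := by
  obtain ⟨h₀, -, hN, h₁, h₂, -⟩ := hs.chained_domain h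
  obtain ⟨x, P, hx⟩ := hs.exists_nf h₀
  obtain ⟨Q, g, -, hNQ, -, -, hnf⟩ := hs.exists_nf_extension hx (K.trans h₁ h₂) hN
  rw [comp_singleton] at hnf
  refine ⟨Fin.snoc a (g x), Q, hNQ, fun i => by simp, N, ?_, by simpa using hnf⟩
  simpa using h

theorem exists_chained_append (h : s.Chained lam th a M₀ M₁ N) {k : ℕ} (hk : n ≤ k) :
    ∃ (c : Fin k → ZFSet.{u}) (Q : Model L), K.Prec N Q ∧ (∀ i, c (Fin.castLE hk i) = a i) ∧
      s.Chained lam th c M₀ M₁ Q := by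
  induction k, hk using Nat.le_induction with
  | base =>
    obtain ⟨-, -, hN, -⟩ := hs.chained_domain h
    exact ⟨a, N, K.refl hN.1, fun _ => rfl, h⟩
  | succ k hk ih =>
    obtain ⟨c, Q, hNQ, hc, hch⟩ := ih
    obtain ⟨d, R, hQR, hd, hch'⟩ := hs.exists_chained_succ hch
    exact ⟨d, R, K.trans hNQ hQR, fun i => (hd (Fin.castLE hk i)).trans (hc i), hch'⟩

/-- The type of an independent sequence is determined by the types over the base of its members. -/
theorem sameType_of_chained : ∀ {n : ℕ} {a b : Fin n → ZFSet.{u}} {N N' : Model L},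
    s.Chained lam th a M₀ M₁ N → s.Chained lam th b M₀ M₁ N' →
      (∀ i, K.SameType lam th M₀ ![a i] N ![b i] N') → K.SameType lam th M₁ a N b N'
  | 0, a, b, N, N', ⟨_, h₁, hN, _, h₃⟩, ⟨_, _, hN', _, h₃'⟩, _ => by
    obtain ⟨Q, g, hQ, hNQ, hg, hgM⟩ := hs.exists_amalgam h₁ hN hN' h₃ h₃'
    exact ⟨Q, id, g, hQ, IsEmb.of_prec hNQ, hg, fun x hx => ⟨rfl, hgM x hx⟩, fun i => i.elim0⟩
  | n + 1, a, b, N, N', ⟨C, hC, hnf⟩, ⟨C', hC', hnf'⟩, hab => by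
    obtain ⟨h₀, h₁, hCF, h₀₁, h₁C, ha⟩ := hs.chained_domain hC
    obtain ⟨-, -, hCF', -, h₁C', hb⟩ := hs.chained_domain hC'
    obtain ⟨-, -, hN, h₀C, hCN, hal, -⟩ := hs.nf_domain hnf
    obtain ⟨-, -, hN', h₀C', hCN', hbl, -⟩ := hs.nf_domain hnf'
    -- The hypothesis compares the entries inside `N` and `N'`; the induction needs them compared
    -- inside `C` and `C'`.
    have hab' : ∀ i : Fin n, K.SameType lam th M₀ ![a i.castSucc] C ![b i.castSucc] C' :=
      fun i => hs.sameType_trans hN (K.trans h₀C hCN)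
        (forall_singleton_mem.2 (Prec.subset hCN (ha i))) (SameType.of_prec hCN hN _)
        (hs.sameType_trans hN' (K.trans h₀C' hCN')
          (forall_singleton_mem.2 (Prec.subset hCN' (hb i))) (hab i.castSucc)
          (SameType.of_prec hCN' hN' _).symm)
    obtain ⟨D, f, hD, hCD, ⟨C₁, hfC, hCD₁⟩, hfM, hfb⟩ :=
      (sameType_of_chained hC hC' hab').exists_prec h₁C ha
    -- The initial segments are now identified inside `D`. Both last entries are extended to types
    -- over `D` that do not fork over `M₀`, the second after transport along `f`.
    obtain ⟨Q, g, hQ, hDQ, hg, hgC, hnfQ⟩ := hs.exists_nf_extension hnf hCD hD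
    obtain ⟨k, P, hk, hCP, hkf⟩ := Prec.exists_extend hCN' hfC
    have hkM : ∀ x ∈ M₁.carrier, k x = x := fun x hx => by
      rw [hkf x (Prec.subset h₁C' hx), hfM x hx]
    have hkC' : IsIso k C' C₁ := hfC.congr fun x hx => (hkf x hx).symm
    have hM₁C₁ : K.Prec M₁ C₁ := K.prec_iso h₁C' (IsIso.of_fixed hkM) hkC'
    have hnfP := hs.nf_invariance hk
      (IsIso.of_fixed fun x hx => hkM x (Prec.subset h₀₁ hx)) hkC' hnf'
    obtain ⟨Q', g', hQ', hDQ', hg', hgC', hnfQ'⟩ := hs.exists_nf_extension hnfP hCD₁ hD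
    rw [comp_singleton] at hnfQ
    rw [comp_singleton fun x => g' (k x)] at hnfQ'
    have hemb : K.IsEmb (fun x => g' (k x)) N' Q' :=
      hg'.comp (IsEmb.of_isIso hk (K.mem_iso hN'.1 hk))
    have hgM₁ : ∀ x ∈ M₁.carrier, g' (k x) = x := fun x hx => by
      rw [hkM x hx, hgC' x (Prec.subset hM₁C₁ hx)]
    have hlast : K.SameType lam th M₀ ![g (a (Fin.last n))] Q ![g' (k (b (Fin.last n)))] Q' := by
      have h₁' : K.SameType lam th M₀ ![g (a (Fin.last n))] Q ![a (Fin.last n)] N :=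
        ⟨Q, id, g, hQ, IsEmb.of_prec (K.refl hQ.1), hg,
          fun x hx => ⟨rfl, hgC x (Prec.subset h₀C hx)⟩, fun i => by simp⟩
      have h₂' : K.SameType lam th M₀ ![b (Fin.last n)] N' ![g' (k (b (Fin.last n)))] Q' :=
        ⟨Q', fun x => g' (k x), id, hQ', hemb, IsEmb.of_prec (K.refl hQ'.1),
          fun x hx => ⟨hgM₁ x (Prec.subset h₀₁ hx), rfl⟩, fun i => by simp⟩
      exact hs.sameType_trans hN (K.trans h₀C hCN) hal h₁'
        (hs.sameType_trans hN' (K.trans h₀C' hCN') hbl (hab (Fin.last n)) h₂')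
    -- Uniqueness over `D` identifies the last entries by a map fixing `D`, which leaves the initial
    -- segments identified.
    obtain ⟨R, r, hR, hQR, hr, hrD, hrl⟩ :=
      (hs.sameType_of_nf hnfQ hnfQ' hlast).exists_prec hDQ
        (forall_singleton_mem.2 (hg.mem (hal 0)))
    refine ⟨R, g, fun x => r (g' (k x)), hR, hg.trans_prec hQR, hr.comp hemb, fun x hx =>
      ⟨hgC x (Prec.subset h₁C hx), ?_⟩, fun i => ?_⟩
    · dsimp only
      rw [hgM₁ x hx, hrD x (Prec.subset hCD (Prec.subset h₁C hx))]
    · induction i using Fin.lastCases with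
      | last => simpa using (hrl 0).symm
      | cast i =>
        dsimp only
        have h₁' : k (b i.castSucc) = a i.castSucc := (hkf _ (hb i)).trans (hfb i)
        have h₂' : a i.castSucc ∈ C₁.carrier := h₁' ▸ hkC'.mem (hb i)
        rw [h₁', hgC' _ h₂', hrD _ (Prec.subset hCD (ha i)), hgC _ (ha i)]

/-- Symmetry is applied over `B` instead of `M₀`, so that the model obtained around `y` contains
`B`. Transitivity then brings the base back to `M₀`. -/
theorem nf_exchange {B C : Model L} (h : s.nf M₀ B ![x] C) (h' : s.nf M₀ C ![y] N) :
    ∃ M₁ N', K.Prec N N' ∧ s.nf M₀ B ![y] M₁ ∧ s.nf M₀ M₁ ![x] N' := by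
  obtain ⟨h₀, hB, hC, h₀B, hBC, hx, hn⟩ := hs.nf_domain h
  obtain ⟨-, -, hN, h₀C, hCN, hy, -⟩ := hs.nf_domain h'
  have hbs := hs.basic_of_nf (hs.nf_base (hs.nf_up h hCN hN) h₀B (K.refl hB.1) (K.refl hB.1))
  obtain ⟨M₁, N', hyM, hNN', hnf⟩ :=
    hs.symmetry (hs.nf_base h' h₀B hBC (K.refl hC.1)) hn hx hbs
  obtain ⟨-, -, hN', hBM₁, hM₁N', -⟩ := hs.nf_domain hnf
  exact ⟨M₁, N', hNN',
    hs.nf_down (hs.nf_up (hs.nf_base h' (K.refl h₀.1) h₀B hBC) hNN' hN') hM₁N' hBM₁ hyM,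
    hs.nf_trans hnf (hs.nf_up h (K.trans hCN hNN') hN')⟩

/-- The element `y` is moved past the entries of `a` one by one, starting from the last. -/
theorem chained_exchange_one {B : Model L} : ∀ {n : ℕ} {a : Fin n → ZFSet.{u}} {C N : Model L},
    s.Chained lam th a M₀ B C → s.nf M₀ C ![y] N →
      ∃ M₁ N', K.Prec N N' ∧ s.nf M₀ B ![y] M₁ ∧ s.Chained lam th a M₀ M₁ N'
  | 0, _, C, N, ⟨h₀, hB, _, h₀B, hBC⟩, hnf => by
    obtain ⟨-, -, hN, -⟩ := hs.nf_domain hnf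
    exact ⟨N, N, K.refl hN.1, hs.nf_base hnf (K.refl h₀.1) h₀B hBC,
      h₀, hN, hN, K.trans (K.trans h₀B hBC) (hs.nf_domain hnf).2.2.2.2.1, K.refl hN.1⟩
  | n + 1, a, C, N, ⟨C', hC', hnf⟩, hnf' => by
    obtain ⟨h₀, -, -, h₀B, hBC', haC'⟩ := hs.chained_domain hC'
    obtain ⟨M₁, N₁, hNN₁, hy, hx⟩ := hs.nf_exchange hnf hnf'
    obtain ⟨M₂, N₂, hMN₂, hy₂, hch⟩ := chained_exchange_one hC' hy
    obtain ⟨-, -, hN₂, -, hM₂N₂, -⟩ := hs.chained_domain hch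
    obtain ⟨-, -, hM₁, -, hC'M₁, hyM₁, -⟩ := hs.nf_domain hy
    -- Moving `y` past the earlier entries enlarged `M₁` to `N₂`, so the last entry is made
    -- independent from a copy of `N₂` over `M₁`. The earlier entries and `y` lie in `M₁` and stay
    -- fixed.
    obtain ⟨Q, D, k, hQ, hNQ, hkD, hDQ, hk, hnfQ⟩ := hs.exists_nf_extension' hx hMN₂ hN₂
    obtain ⟨E, hkE, hED⟩ := Prec.exists_image hM₂N₂ hkD
    have hB : ∀ x ∈ B.carrier, k x = x := fun x hx =>
      hk x (Prec.subset hC'M₁ (Prec.subset hBC' hx))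
    have hM₀ : ∀ x ∈ M₀.carrier, k x = x := fun x hx => hB x (Prec.subset h₀B hx)
    refine ⟨E, Q, K.trans hNN₁ hNQ, ?_, D, ?_, hnfQ⟩
    · have := hs.nf_invariance hkE (IsIso.of_fixed hM₀) (IsIso.of_fixed hB) hy₂
      rwa [comp_singleton, hk y (hyM₁ 0)] at this
    · have := hs.chained_iso (IsIso.of_fixed hM₀) hkE hch hkD
      rwa [show (fun i : Fin n => k (a i.castSucc)) = fun i => a i.castSucc from
        funext fun i => hk _ (Prec.subset hC'M₁ (haC' i))] at this

/-- Two independent sequences can be interchanged. -/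
theorem chained_exchange {B C : Model L} (ha : s.Chained lam th a M₀ B C) :
    ∀ {m : ℕ} {b : Fin m → ZFSet.{u}} {N : Model L}, s.Chained lam th b M₀ C N →
      ∃ M₁ N', K.Prec N N' ∧ s.Chained lam th b M₀ B M₁ ∧ s.Chained lam th a M₀ M₁ N'
  | 0, b, N, ⟨h₀, _, hN, _, hCN⟩ => by
    obtain ⟨-, hB, -, h₀B, -⟩ := hs.chained_domain ha
    exact ⟨B, N, K.refl hN.1, ⟨h₀, hB, hB, h₀B, K.refl hB.1⟩, hs.chained_up ha hCN hN⟩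
  | m + 1, b, N, ⟨D, hD, hnf⟩ => by
    obtain ⟨-, -, -, h₀B, hBC, haC⟩ := hs.chained_domain ha
    obtain ⟨-, -, -, -, hCD, hbD⟩ := hs.chained_domain hD
    obtain ⟨M₁, N₁, hDN₁, hb, ha₁⟩ := chained_exchange ha hD
    obtain ⟨-, -, hN₁, -, hM₁N₁, -⟩ := hs.chained_domain ha₁
    -- The induction exchanged `a` with all of `b` but its last entry, inside `N₁`. That entry is
    -- made independent from a copy of `N₁` over `D`, and is then moved past `a` on its own.
    obtain ⟨Q, E, k, hQ, hNQ, hkE, hEQ, hk, hnfQ⟩ := hs.exists_nf_extension' hnf hDN₁ hN₁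
    obtain ⟨M₂, hkM₂, -⟩ := Prec.exists_image hM₁N₁ hkE
    have hB : ∀ x ∈ B.carrier, k x = x := fun x hx => hk x (Prec.subset hCD (Prec.subset hBC hx))
    have hM₀ : ∀ x ∈ M₀.carrier, k x = x := fun x hx => hB x (Prec.subset h₀B hx)
    have ha₂ := hs.chained_iso (IsIso.of_fixed hM₀) hkM₂ ha₁ hkE
    rw [show (fun i => k (a i)) = a from
      funext fun i => hk _ (Prec.subset hCD (haC i))] at ha₂
    have hb₂ := hs.chained_iso (IsIso.of_fixed hM₀) (IsIso.of_fixed hB) hb hkM₂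
    rw [show (fun i : Fin m => k (b i.castSucc)) = fun i => b i.castSucc from
      funext fun i => hk _ (hbD i)] at hb₂
    obtain ⟨M₃, N₃, hQN₃, hbl, ha₃⟩ := hs.chained_exchange_one ha₂ hnfQ
    exact ⟨M₃, N₃, K.trans hNQ hQN₃, ⟨M₂, hb₂, hbl⟩, ha₃⟩

end IsGoodExceptStability

end

/-! ### Entries and restrictions of Galois types, then the axioms for the elongation. -/

section

open AEC

variable {L : FirstOrder.Language.{u, u}} {K : AEC L} {M M₀ M₁ N N' P : Model L}
  {f g : ZFSet.{u} → ZFSet.{u}} {lam : Cardinal.{u}} {th : WithTop Cardinal.{u}}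
  {s t : FrameTriple K} {α β : ℕ∞} {m n : ℕ} {a b c : Fin n → ZFSet.{u}} {x y : ZFSet.{u}}

namespace GType

/-- The type of the member with index `k`. -/
def coord (p : GType K M n) (k : ℕ) (hk : k < n) : GType K M 1 :=
  Quot.map
    (fun r : Realization K M n =>
      (⟨r.ambient, r.prec, ![r.tuple ⟨k, hk⟩], forall_singleton_mem.2 (r.mem _)⟩ :
        Realization K M 1))
    (fun _ _ ⟨N, f, g, hf, hg, hfg, hi⟩ =>
      ⟨N, f, g, hf, hg, hfg, fun i => by simpa using hi ⟨k, hk⟩⟩) p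

theorem coord_restrict (p : GType K M n) (h : K.Prec M₀ M) (hm : m ≤ n) (k : ℕ) (hk : k < m) :
    (p.restrict h hm).coord k hk = (p.coord k (hk.trans_le hm)).restrict h le_rfl := by
  induction p using Quot.ind
  rfl

theorem restrict_refl (p : GType K M n) (h : K.Prec M M) : p.restrict h le_rfl = p := by
  induction p using Quot.ind
  rfl

theorem restrict_restrict {k : ℕ} (p : GType K N n) (h : K.Prec M N) (h' : K.Prec M₀ M)
    (hm : m ≤ n) (hk : k ≤ m) :
    (p.restrict h hm).restrict h' hk = p.restrict (K.trans h' h) (hk.trans hm) := by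
  induction p using Quot.ind
  rfl

/-- Nonalgebraicity asks for one good realization. Embeddings are injective and fix `M`, so the
property passes along the generating relation to every realization. -/
theorem Nonalgebraic.notMem {h : K.Prec M N} {ha : ∀ i, a i ∈ N.carrier}
    (hp : (tp h ha).Nonalgebraic) (i : Fin n) : a i ∉ M.carrier := by
  have key : ∀ r r' : Realization K M n, Realization.AtomicEq r r' →
      (∀ i, r.tuple i ∉ M.carrier) → ∀ i, r'.tuple i ∉ M.carrier := by
    rintro r r' ⟨N, f, g, hf, hg, hfg, hi⟩ hr i hM
    have h₁ : f (r.tuple i) = f (r'.tuple i) := by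
      rw [hi, (hfg _ hM).2, (hfg _ hM).1]
    exact hr i (hf.injOn (r.mem i) (Prec.subset r.prec hM) h₁ ▸ hM)
  have key' : ∀ r r' : Realization K M n, Realization.AtomicEq r r' →
      (∀ i, r.tuple i ∉ M.carrier) = ∀ i, r'.tuple i ∉ M.carrier := fun r r' hr =>
    propext ⟨key r r' hr, key r' r (by
      obtain ⟨N, f, g, hf, hg, hfg, hi⟩ := hr
      exact ⟨N, g, f, hg, hf, fun x hx => (hfg x hx).symm, fun i => (hi i).symm⟩)⟩
  obtain ⟨r, hr, hrM⟩ := hp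
  have := congrArg (Quot.lift _ key') hr
  exact (this.mp hrM) i

end GType

namespace IsPreFrame

theorem doesNotFork_base (hs : IsPreFrame α lam th s) {M₀' : Model L} {p : GType K M₁ n}
    (hp : s.DoesNotFork p M₀) (h : K.Prec M₀ M₀') (h' : K.Prec M₀' M₁) :
    s.DoesNotFork p M₀' := by
  obtain ⟨a, N, h₁, ha, rfl, hnf⟩ := hp
  exact ⟨a, N, h₁, ha, rfl, hs.nf_base hnf h h' (K.refl (K.mem_of_prec h').2)⟩

theorem doesNotFork_restrict (hs : IsPreFrame α lam th s) {M₁' : Model L} {p : GType K M₁ n}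
    (hp : s.DoesNotFork p M₀) (h : K.Prec M₀ M₁') (h' : K.Prec M₁' M₁) (hm : m ≤ n) :
    s.DoesNotFork (p.restrict h' hm) M₀ := by
  obtain ⟨a, N, h₁, ha, rfl, hnf⟩ := hp
  obtain ⟨h₀, -, hN, -⟩ := hs.nf_domain hnf
  have hr := K.refl hN.1
  exact ⟨_, N, K.trans h' h₁, fun i => ha _, rfl,
    (hs.nf_monotonicity (Fin.castLEOrderEmb hm) hnf (K.refl h₀.1) h h' h₁ hr hr hN
      fun i => ha _).1⟩

end IsPreFrame

/-! ### The elongation -/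

theorem IsPreFrame.chained_of_chain (hs : IsPreFrame α lam th s) :
    ∀ {n : ℕ} {a : Fin n → ZFSet.{u}} {C : Fin (n + 1) → Model L}, K.InF lam th M₀ →
      (∀ i, K.InF lam th (C i)) → K.Prec M₀ (C 0) →
      (∀ i : Fin n, s.nf M₀ (C i.castSucc) ![a i] (C i.succ)) →
        s.Chained lam th a M₀ (C 0) (C (Fin.last n))
  | 0, _, _, h₀, hC, h, _ => ⟨h₀, hC 0, hC _, h, K.refl (hC 0).1⟩
  | n + 1, _, C, h₀, hC, h, hnf =>
    ⟨C (Fin.last n).castSucc,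
      chained_of_chain hs (C := fun i : Fin (n + 1) => C i.castSucc) h₀ (fun _ => hC _) h
        (fun i => hnf i.castSucc), hnf (Fin.last n)⟩

theorem IsPreFrame.exists_chain (hs : IsPreFrame α lam th s) :
    ∀ {n : ℕ} {a : Fin n → ZFSet.{u}} {N : Model L}, s.Chained lam th a M₀ M₁ N →
      ∃ C : Fin (n + 1) → Model L, C 0 = M₁ ∧ (∀ i j, i ≤ j → K.Prec (C i) (C j)) ∧
        (∀ i, K.InF lam th (C i)) ∧ K.Prec (C (Fin.last n)) N ∧
          ∀ i : Fin n, s.nf M₀ (C i.castSucc) ![a i] (C i.succ)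
  | 0, _, _, ⟨_, h₁, _, _, h₂⟩ =>
    ⟨fun _ => M₁, rfl, fun _ _ _ => K.refl h₁.1, fun _ => h₁, h₂, fun i => i.elim0⟩
  | n + 1, a, N, ⟨D, hD, hnf⟩ => by
    obtain ⟨h₀, -, -, h₀₁, -, -⟩ := hs.chained_domain hD
    obtain ⟨-, -, hN, -, hDN, -⟩ := hs.nf_domain hnf
    obtain ⟨C, hC₀, hC, hCF, hCD, hCnf⟩ := exists_chain hs hD
    refine ⟨Fin.snoc (α := fun _ => Model L) C N, ?_, fun i j hij => ?_, fun i => ?_, ?_,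
      fun i => ?_⟩
    · rw [← Fin.castSucc_zero, Fin.snoc_castSucc, hC₀]
    · induction j using Fin.lastCases with
      | last =>
        induction i using Fin.lastCases with
        | last => simpa using K.refl hN.1
        | cast i => simpa using K.trans (hC i _ (Fin.le_last i)) (K.trans hCD hDN)
      | cast j =>
        induction i using Fin.lastCases with
        | last => exact absurd (Fin.castSucc_lt_last j) (not_lt_of_ge hij)
        | cast i => simpa using hC i j (Fin.castSucc_le_castSucc_iff.1 hij)
    · induction i using Fin.lastCases with
      | last => simpa using hN
      | cast i => simpa using hCF i
    · simpa using K.refl hN.1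
    · induction i using Fin.lastCases with
      | last =>
        rw [Fin.snoc_castSucc, Fin.succ_last, Fin.snoc_last]
        -- The last model of `C` may be smaller than `D`, and monotonicity passes down to it.
        exact hs.nf_base hnf (K.refl h₀.1)
          (K.trans h₀₁ (hC₀ ▸ hC 0 (Fin.last n) (Fin.zero_le _))) hCD
      | cast i =>
        rw [Fin.snoc_castSucc, Fin.succ_castSucc, Fin.snoc_castSucc]
        exact hCnf i

theorem IsPreFrame.elongation_nf_iff (hs : IsPreFrame α lam th s) :
    (s.elongation ⊤ lam th).nf M₀ M₁ a N ↔ K.InF lam th N ∧ K.Prec M₁ N ∧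
      (∀ i, a i ∈ N.carrier) ∧ ∃ N₁, K.Prec N N₁ ∧ s.Chained lam th a M₀ M₁ N₁ := by
  constructor
  · rintro ⟨-, h₀, h₁, hN, h₀₁, h₁N, ha, C, N₁, rfl, hCN, hNN, hmono, hCF, -, -, -, -, -, -, hnf⟩
    -- The model containing both the chain and `N` need not lie in `K_𝓕`; Löwenheim-Skolem replaces
    -- it by one that does.
    obtain ⟨N₂, hN₂, -, h₂, h₂'⟩ := (hCF (Fin.last n)).exists_prec_of_prec hs.ls_le hN hCN hNN
    exact ⟨hN, h₁N, ha, N₂, h₂', hs.chained_up (hs.chained_of_chain h₀ hCF h₀₁ hnf) h₂ hN₂⟩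
  · rintro ⟨hN, h₁N, ha, N₁, hNN, hch⟩
    obtain ⟨h₀, h₁, hN₁, h₀₁, -⟩ := hs.chained_domain hch
    obtain ⟨C, rfl, hmono, hCF, hCN, hnf⟩ := hs.exists_chain hch
    exact ⟨ENat.natCast_lt_top n, h₀, h₁, hN, h₀₁, h₁N, ha, C, N₁, rfl, hCN, hNN, hmono, hCF, h₀₁,
      K.refl h₁.1, h₀, h₁, K.refl (hCF _).1, hCF _, hnf⟩

theorem IsPreFrame.elongation_nf_of_chained (hs : IsPreFrame α lam th s)
    (h : s.Chained lam th a M₀ M₁ N) : (s.elongation ⊤ lam th).nf M₀ M₁ a N := by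
  obtain ⟨-, -, hN, -, h₁, ha⟩ := hs.chained_domain h
  exact hs.elongation_nf_iff.2 ⟨hN, h₁, ha, N, K.refl hN.1, h⟩

theorem IsPreFrame.elongation_doesNotFork_iff (hs : IsPreFrame α lam th s) {p : GType K M₁ n} :
    (s.elongation ⊤ lam th).DoesNotFork p M₀ ↔ ∃ (a : Fin n → ZFSet.{u}) (N : Model L)
      (h : K.Prec M₁ N) (ha : ∀ i, a i ∈ N.carrier),
        p = tp h ha ∧ s.Chained lam th a M₀ M₁ N := by
  constructor
  · rintro ⟨a, N, h, ha, rfl, hnf⟩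
    obtain ⟨-, -, -, N₁, hNN, hch⟩ := hs.elongation_nf_iff.1 hnf
    exact ⟨a, N₁, K.trans h hNN, fun i => Prec.subset hNN (ha i), tp_eq_of_prec _ hNN _ _ _, hch⟩
  · rintro ⟨a, N, h, ha, rfl, hch⟩
    exact ⟨a, N, h, ha, rfl, hs.elongation_nf_of_chained hch⟩

theorem elongation_mem_bs_iff {p : GType K M n} :
    p ∈ (s.elongation ⊤ lam th).bs M n ↔ (s.elongation ⊤ lam th).DoesNotFork p M := by
  constructor
  · rintro ⟨hn, hM, a, N, h, ha, rfl, hN, hind⟩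
    exact ⟨a, N, h, ha, rfl, hn, hM, hM, hN, hind⟩
  · rintro ⟨a, N, h, ha, rfl, hn, hM, -, hN, hind⟩
    exact ⟨hn, hM, a, N, h, ha, rfl, hN, hind⟩

namespace IsGoodExceptStability

variable (hs : IsGoodExceptStability α lam th s)
include hs

/-- Equality of types carries the chain of another realization to a chain for `a` in an extension of
`N`. -/
theorem elongation_nf_of_doesNotFork (hN : K.InF lam th N) {h : K.Prec M₁ N}
    {ha : ∀ i, a i ∈ N.carrier} (hp : (s.elongation ⊤ lam th).DoesNotFork (tp h ha) M₀) :
    (s.elongation ⊤ lam th).nf M₀ M₁ a N := by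
  obtain ⟨b, N', h', hb, heq, hch⟩ := hs.elongation_doesNotFork_iff.1 hp
  obtain ⟨-, h₁, hN', -⟩ := hs.chained_domain hch
  obtain ⟨R, g, hR, hNR, hg, hgM, hgb⟩ := (hs.sameType_of_tp_eq h₁ hN hN' heq).exists_prec h ha
  have := hs.chained_emb hch hg hR hgM
  rw [funext hgb] at this
  exact hs.elongation_nf_iff.2 ⟨hN, h, ha, R, hNR, this⟩

/-- The ambient model of a basic type may be too large for `K_𝓕`, so it is cut down to a submodel
containing the tuple. -/
theorem elongation_basic_iff : (s.elongation ⊤ lam th).Basic M a N ↔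
    ∃ N₀, K.Prec N₀ N ∧ (s.elongation ⊤ lam th).nf M M a N₀ := by
  constructor
  · rintro ⟨h, ha, hp⟩
    obtain ⟨N₀, hN₀, h₀, hMN₀, ha₀⟩ := hp.2.1.exists_prec_of_tuple hs.ls_le h ha
    have heq := tp_eq_of_prec hMN₀ h₀ ha₀ h ha
    exact ⟨N₀, h₀, hs.elongation_nf_of_doesNotFork hN₀ (h := hMN₀) (ha := ha₀)
      (heq ▸ elongation_mem_bs_iff.1 hp)⟩
  · rintro ⟨N₀, h₀, hnf⟩
    obtain ⟨-, hMN₀, ha, -⟩ := hs.elongation_nf_iff.1 hnf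
    refine ⟨K.trans hMN₀ h₀, fun i => Prec.subset h₀ (ha i), elongation_mem_bs_iff.2
      ⟨a, N₀, hMN₀, ha, (tp_eq_of_prec hMN₀ h₀ ha _ _).symm, hnf⟩⟩

theorem elongation_nf_invariance {M₀' M₁' : Model L} (hN : IsIso f N N') (h₀ : IsIso f M₀ M₀')
    (h₁ : IsIso f M₁ M₁') (h : (s.elongation ⊤ lam th).nf M₀ M₁ a N) :
    (s.elongation ⊤ lam th).nf M₀' M₁' (fun i => f (a i)) N' := by
  obtain ⟨hNF, h₁N, ha, N₁, hNN₁, hch⟩ := hs.elongation_nf_iff.1 h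
  obtain ⟨-, -, -, h₀₁, -⟩ := hs.chained_domain hch
  obtain ⟨g, N₁', hg, hNN₁', hgf⟩ := Prec.exists_extend hNN₁ hN
  have hgM : ∀ x ∈ M₁.carrier, f x = g x := fun x hx => (hgf x (Prec.subset h₁N hx)).symm
  refine hs.elongation_nf_iff.2 ⟨hNF.of_isIso hN, K.prec_iso h₁N h₁ hN, fun i => hN.mem (ha i),
    N₁', hNN₁', ?_⟩
  have := hs.chained_iso (h₀.congr fun x hx => hgM x (Prec.subset h₀₁ hx)) (h₁.congr hgM) hch hg
  rwa [show (fun i => g (a i)) = fun i => f (a i) from funext fun i => hgf _ (ha i)] at this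

theorem elongation_nf_monotonicity {M₀' M₁' N'' : Model L} (e : Fin m ↪o Fin n)
    (h : (s.elongation ⊤ lam th).nf M₀ M₁ a N) (h₀ : K.Prec M₀ M₀') (h₁ : K.Prec M₀' M₁')
    (h₂ : K.Prec M₁' M₁) (h₃ : K.Prec M₁ N') (h₄ : K.Prec N' N) (h₅ : K.Prec N N'')
    (hN'' : K.InF lam th N'') (ha : ∀ i, a (e i) ∈ N'.carrier) :
    (s.elongation ⊤ lam th).nf M₀' M₁' (fun i => a (e i)) N' ∧
      (s.elongation ⊤ lam th).nf M₀' M₁' (fun i => a (e i)) N'' := by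
  obtain ⟨hN, h₁N, haN, N₁, hNN₁, hch⟩ := hs.elongation_nf_iff.1 h
  have hch' := hs.chained_subsequence (hs.chained_base h₀ h₁ h₂ hch) e e.strictMono
  obtain ⟨-, hM₁, hN₁, -⟩ := hs.chained_domain hch
  refine ⟨hs.elongation_nf_iff.2 ⟨hM₁.of_between hN h₃ h₄, K.trans h₂ h₃, ha, N₁,
    K.trans h₄ hNN₁, hch'⟩, hs.elongation_nf_iff.2 ⟨hN'', K.trans h₂ (K.trans h₁N h₅),
    fun i => Prec.subset h₅ (haN _), ?_⟩⟩
  -- The chain lives in `N₁`, which need not be compatible with `N''`; amalgamation over `N` carries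
  -- it to an extension of `N''` without moving the tuple.
  obtain ⟨Q, g, hQ, hNQ, hg, hgN⟩ := hs.exists_amalgam hN hN'' hN₁ h₅ hNN₁
  have := hs.chained_emb hch' hg hQ
    fun x hx => hgN x (Prec.subset h₁N (Prec.subset h₂ hx))
  rw [show (fun i => g (a (e i))) = fun i => a (e i) from funext fun i => hgN _ (haN _)] at this
  exact ⟨Q, hNQ, this⟩

theorem elongation_nonalgebraic {p : GType K M n} (hp : p ∈ (s.elongation ⊤ lam th).bs M n) :
    p.Nonalgebraic := by
  obtain ⟨a, N, h, ha, rfl, hch⟩ := hs.elongation_doesNotFork_iff.1 (elongation_mem_bs_iff.1 hp)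
  refine ⟨⟨N, h, a, ha⟩, rfl, fun i => ?_⟩
  obtain ⟨_, _, hbs⟩ := hs.basic_of_nf (hs.nf_of_chained hch i)
  exact (hs.bs_subset _ hbs).2.2.notMem 0

theorem isPreFrame_elongation : IsPreFrame ⊤ lam th (s.elongation ⊤ lam th) where
  lt := hs.lt
  ls_le := hs.ls_le
  exists_size_eq := hs.exists_size_eq
  bs_subset p hp := ⟨hp.2.1, hp.1, hs.elongation_nonalgebraic hp⟩
  nf_domain h := by
    obtain ⟨hn, h₀, h₁, hN, h₀₁, h₁N, ha, -⟩ := h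
    exact ⟨h₀, h₁, hN, h₀₁, h₁N, ha, hn⟩
  nf_invariance hN h₀ h₁ h := hs.elongation_nf_invariance hN h₀ h₁ h
  bs_invariance hN hM h := by
    obtain ⟨N₀, h₀, hnf⟩ := hs.elongation_basic_iff.1 h
    obtain ⟨N₀', hN₀', h₀'⟩ := Prec.exists_image h₀ hN
    exact hs.elongation_basic_iff.2 ⟨N₀', h₀', hs.elongation_nf_invariance hN₀' hM hM hnf⟩
  nf_monotonicity e h h₀ h₁ h₂ h₃ h₄ h₅ hN ha :=
    hs.elongation_nf_monotonicity e h h₀ h₁ h₂ h₃ h₄ h₅ hN ha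
  bs_monotonicity e h := by
    obtain ⟨N₀, h₀, hnf⟩ := hs.elongation_basic_iff.1 h
    obtain ⟨hN₀, hM, ha, -⟩ := hs.elongation_nf_iff.1 hnf
    have hr := K.refl hN₀.1
    have hr' := K.refl (K.mem_of_prec hM).1
    exact hs.elongation_basic_iff.2 ⟨N₀, h₀,
      (hs.elongation_nf_monotonicity e hnf hr' hr' hr' hM hr hr hN₀ fun i => ha _).1⟩
  basic_of_nf h := hs.elongation_basic_iff.2 ⟨_, K.refl h.2.2.2.1.1, h⟩

theorem elongation_bs_one : (s.elongation ⊤ lam th).bs M 1 = s.bs M 1 := by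
  ext p
  rw [elongation_mem_bs_iff, hs.elongation_doesNotFork_iff]
  constructor
  · rintro ⟨a, N, h, ha, rfl, hch⟩
    obtain ⟨x, rfl⟩ : ∃ x, a = ![x] := ⟨a 0, by ext1 i; rw [Fin.fin_one_eq_zero i]; rfl⟩
    obtain ⟨_, _, hbs⟩ := hs.basic_of_nf (hs.chained_one.1 hch)
    exact hbs
  · intro hp
    obtain ⟨a, N, h, ha, rfl, hnf⟩ := hs.doesNotFork_of_mem_bs hp
    obtain ⟨x, rfl⟩ : ∃ x, a = ![x] := ⟨a 0, by ext1 i; rw [Fin.fin_one_eq_zero i]; rfl⟩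
    exact ⟨_, N, h, ha, rfl, hs.chained_one.2 hnf⟩

/-- The sequence is lengthened over `M` first, and only then extended over `N`. -/
theorem elongation_existence {p : GType K M m} (hp : p ∈ (s.elongation ⊤ lam th).bs M m)
    (hMN : K.Prec M N) (hN : K.InF lam th N) (hmn : m ≤ n) :
    ∃ q ∈ (s.elongation ⊤ lam th).bs N n,
      (s.elongation ⊤ lam th).DoesNotFork q M ∧ q.Extends p := by
  obtain ⟨a, P, h, ha, rfl, hch⟩ := hs.elongation_doesNotFork_iff.1 (elongation_mem_bs_iff.1 hp)
  obtain ⟨c, P', hPP', hca, hch'⟩ := hs.exists_chained_append hch hmn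
  obtain ⟨Q, g, hQ, hNQ, hg, hgM, hchQ⟩ := hs.exists_chained_extension hch' hMN hN
  obtain ⟨-, -, -, -, -, hc⟩ := hs.chained_domain hchQ
  have hdnf : (s.elongation ⊤ lam th).DoesNotFork (tp hNQ hc) M :=
    hs.elongation_doesNotFork_iff.2 ⟨_, Q, hNQ, hc, rfl, hchQ⟩
  refine ⟨tp hNQ hc, elongation_mem_bs_iff.2
    (hs.isPreFrame_elongation.doesNotFork_base hdnf hMN (K.refl hN.1)), hdnf, hMN, hmn, ?_⟩
  refine SameType.tp_eq (lam := lam) (th := th) ⟨Q, id, g, hQ, IsEmb.of_prec (K.refl hQ.1),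
    hg.restrict hPP', fun x hx => ⟨rfl, hgM x hx⟩, fun i => ?_⟩ _ _ _ _
  simp [hca]

theorem elongation_uniqueness (p q : GType K N n) (h : K.Prec M N)
    (hp : (s.elongation ⊤ lam th).DoesNotFork p M) (hq : (s.elongation ⊤ lam th).DoesNotFork q M)
    (hpq : p.restrict h le_rfl = q.restrict h le_rfl) : p = q := by
  obtain ⟨a, N₁, h₁, ha, rfl, hch⟩ := hs.elongation_doesNotFork_iff.1 hp
  obtain ⟨b, N₂, h₂, hb, rfl, hch'⟩ := hs.elongation_doesNotFork_iff.1 hq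
  obtain ⟨hM, -, hN₁, -⟩ := hs.chained_domain hch
  obtain ⟨-, -, hN₂, -⟩ := hs.chained_domain hch'
  have hab : K.SameType lam th M a N₁ b N₂ :=
    hs.sameType_of_tp_eq hM hN₁ hN₂ (h := K.trans h h₁) (h' := K.trans h h₂) (ha := ha) (hb := hb)
      hpq
  refine (hs.sameType_of_chained hch hch' fun i => ?_).tp_eq _ _ _ _
  have := hab.comp (fun _ : Fin 1 => i)
  rwa [show (fun _ : Fin 1 => a i) = ![a i] from funext fun j => by simp,
    show (fun _ : Fin 1 => b i) = ![b i] from funext fun j => by simp] at this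

theorem elongation_symmetry {M₂ : Model L} {a₁ : Fin m → ZFSet.{u}} {a₂ : Fin n → ZFSet.{u}}
    (h : (s.elongation ⊤ lam th).nf M₀ M₂ a₁ N) (ha₂ : ∀ i, a₂ i ∈ M₂.carrier)
    (hbs : (s.elongation ⊤ lam th).Basic M₀ a₂ N) :
    ∃ M₁ N', (∀ i, a₁ i ∈ M₁.carrier) ∧ K.Prec N N' ∧
      (s.elongation ⊤ lam th).nf M₀ M₁ a₂ N' := by
  obtain ⟨hN, h₂N, -, Y, hNY, hch⟩ := hs.elongation_nf_iff.1 h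
  obtain ⟨h₀, hM₂, -, h₀₂, -⟩ := hs.chained_domain hch
  obtain ⟨hb, hbN, hbs⟩ := hbs
  have hbs' : (s.elongation ⊤ lam th).DoesNotFork (tp h₀₂ ha₂) M₀ := by
    rw [tp_eq_of_prec h₀₂ h₂N ha₂ hb hbN]
    exact elongation_mem_bs_iff.1 hbs
  -- The sequence `a₂` lies in `M₂`, but its chain may need a larger model `X`. So `a₁` is made
  -- independent from a copy of `X` over `M₂`, and then the two sequences are exchanged.
  obtain ⟨-, -, -, X, hMX, hch'⟩ :=
    hs.elongation_nf_iff.1 (hs.elongation_nf_of_doesNotFork hM₂ hbs')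
  obtain ⟨-, -, hX, -⟩ := hs.chained_domain hch'
  obtain ⟨Q, D, k, hQ, hYQ, hkD, hDQ, hk, hchQ⟩ := hs.exists_chained_extension' hMX hX hch
  have hk₀ : IsIso k M₀ M₀ := IsIso.of_fixed fun x hx => hk x (Prec.subset h₀₂ hx)
  have hchD := hs.chained_iso hk₀ hk₀ hch' hkD
  rw [show (fun i => k (a₂ i)) = a₂ from funext fun i => hk _ (ha₂ i)] at hchD
  obtain ⟨M₁, N', hQN', hch₁, hch₂⟩ := hs.chained_exchange hchD hchQ
  obtain ⟨-, -, -, -, -, ha₁⟩ := hs.chained_domain hch₁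
  exact ⟨M₁, N', ha₁, K.trans hNY (K.trans hYQ hQN'), hs.elongation_nf_of_chained hch₂⟩

theorem elongation_transitivity {M₂ : Model L} (p : GType K M₂ n) (h₀₁ : K.Prec M₀ M₁)
    (h : K.Prec M₁ M₂) (hp : (s.elongation ⊤ lam th).DoesNotFork p M₁)
    (hp' : (s.elongation ⊤ lam th).DoesNotFork (p.restrict h le_rfl) M₀) :
    (s.elongation ⊤ lam th).DoesNotFork p M₀ := by
  obtain ⟨a, N, h₂N, ha, rfl, hch⟩ := hs.elongation_doesNotFork_iff.1 hp
  obtain ⟨-, -, hN, -⟩ := hs.chained_domain hch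
  obtain ⟨-, -, -, N₁, hNN₁, hch'⟩ :=
    hs.elongation_nf_iff.1 (hs.elongation_nf_of_doesNotFork hN hp')
  obtain ⟨h₀, -, hN₁, -⟩ := hs.chained_domain hch'
  exact hs.elongation_doesNotFork_iff.2 ⟨a, N₁, K.trans h₂N hNN₁,
    fun i => Prec.subset hNN₁ (ha i), tp_eq_of_prec _ hNN₁ _ _ _,
    hs.chained_trans (hs.chained_up hch hNN₁ hN₁) h₀ h₀₁ (hs.nf_of_chained hch')⟩

theorem coord_mem_bs {p : GType K M n} (hp : p ∈ (s.elongation ⊤ lam th).bs M n) (k : ℕ)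
    (hk : k < n) : p.coord k hk ∈ s.bs M 1 := by
  obtain ⟨a, N, h, ha, rfl, hch⟩ := hs.elongation_doesNotFork_iff.1 (elongation_mem_bs_iff.1 hp)
  obtain ⟨_, _, hbs⟩ := hs.basic_of_nf (hs.nf_of_chained hch ⟨k, hk⟩)
  exact hbs

/-- Whether a basic type of the elongation forks is decided by the types of the members. -/
theorem elongation_doesNotFork_of_coord {p : GType K M₁ n}
    (hp : p ∈ (s.elongation ⊤ lam th).bs M₁ n) (hM₀ : K.InF lam th M₀) (h₀₁ : K.Prec M₀ M₁)
    (h : ∀ k hk, s.DoesNotFork (p.coord k hk) M₀) :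
    (s.elongation ⊤ lam th).DoesNotFork p M₀ := by
  obtain ⟨a, N, h₁, ha, rfl, hch⟩ := hs.elongation_doesNotFork_iff.1 (elongation_mem_bs_iff.1 hp)
  obtain ⟨-, -, hN, -⟩ := hs.chained_domain hch
  refine hs.elongation_doesNotFork_iff.2 ⟨a, N, h₁, ha, rfl,
    hs.chained_trans hch hM₀ h₀₁ fun i => ?_⟩
  exact (hs.doesNotFork_tp_iff hs.toIsPreFrame hN).1 (h i i.2)

end IsGoodExceptStability

end

/-! ### Local character and continuity of the elongation, and the conclusion. -/

section

open AEC

variable {L : FirstOrder.Language.{u, u}} {K : AEC L}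
  {lam : Cardinal.{u}} {th : WithTop Cardinal.{u}} {s : FrameTriple K} {α : ℕ∞} {n : ℕ}
  {δ i₀ : Ordinal.{u}} {M : Ordinal.{u} → Model L}

theorem exists_lt_forall_le (hi₀ : i₀ < δ) {J : Fin n → Ordinal.{u}} (hJ : ∀ k, J k < δ) :
    ∃ j < δ, i₀ ≤ j ∧ ∀ k, J k ≤ j :=
  ⟨max i₀ (Finset.univ.sup J), max_lt hi₀ ((Finset.sup_lt_iff (bot_le.trans_lt hi₀)).2
    fun k _ => hJ k), le_max_left _ _, fun k => (Finset.le_sup (Finset.mem_univ k)).trans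
      (le_max_right _ _)⟩

/-- A continuous increasing sequence remains so if an initial segment is made constant. -/
theorem IncreasingContinuous.max_const (hM : IncreasingContinuous K.Prec (Order.succ δ) M)
    (hi₀ : i₀ < δ) : IncreasingContinuous K.Prec (Order.succ δ) fun i => M (max i i₀) := by
  have hlt : ∀ i, i < Order.succ δ → max i i₀ < Order.succ δ := fun i hi =>
    max_lt hi (hi₀.trans (Order.lt_succ δ))
  refine ⟨fun i j hij hj => hM.1 _ _ (max_le_max_right _ hij) (hlt j hj), fun i hi hlim => ?_⟩
  refine ⟨?_, fun j hj => K.isSubstructure (hM.1 _ _ (max_le_max_right _ hj.le) (hlt i hi))⟩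
  rcases le_or_gt i i₀ with h | h
  · ext x
    simp only [Set.mem_ofPred_eq, max_eq_right h]
    constructor
    · intro hx
      exact ⟨0, hlim.bot_lt, by rwa [max_eq_right zero_le]⟩
    · rintro ⟨j, hj, hx⟩
      rwa [max_eq_right (hj.le.trans h)] at hx
  · ext x
    simp only [Set.mem_ofPred_eq, max_eq_left h.le]
    rw [(hM.2 i hi hlim).1]
    constructor
    · rintro ⟨j, hj, hx⟩
      exact ⟨j, hj, Prec.subset (hM.1 _ _ (le_max_left _ _)
        (hlt j (hj.trans hi))) hx⟩
    · rintro ⟨j, hj, hx⟩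
      exact ⟨_, max_lt hj h, hx⟩

theorem GType.Extends.trans {M₀ M₁ M₂ : Model L} {k l m : ℕ} {p : GType K M₀ k} {q : GType K M₁ l}
    {r : GType K M₂ m} (hr : r.Extends q) (hq : q.Extends p) : r.Extends p := by
  obtain ⟨h, hm, rfl⟩ := hr
  obtain ⟨h', hm', rfl⟩ := hq
  exact ⟨K.trans h' h, hm'.trans hm, (r.restrict_restrict _ _ _ _).symm⟩

theorem GType.Extends.coord {M₀ M₁ : Model L} {k l : ℕ} {p : GType K M₀ k} {q : GType K M₁ l}
    (hq : q.Extends p) (i : ℕ) (hi : i < k) (hi' : i < l) :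
    (q.coord i hi').Extends (p.coord i hi) := by
  obtain ⟨h, hm, rfl⟩ := hq
  exact ⟨h, le_rfl, (q.coord_restrict h hm i hi).symm⟩

namespace IsGoodExceptStability

variable (hs : IsGoodExceptStability α lam th s)
include hs

/-- Each entry has its own index by local character at length one, and a maximum of finitely many
indices below `δ` works for all of them. -/
theorem elongation_local_character (hδ : Order.IsSuccLimit δ)
    (hM : IncreasingContinuous K.Prec (Order.succ δ) M) (hMF : ∀ i ≤ δ, K.InF lam th (M i))
    {p : GType K (M δ) n} (hp : p ∈ (s.elongation ⊤ lam th).bs (M δ) n) :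
    ∃ i < δ, (s.elongation ⊤ lam th).DoesNotFork p (M i) := by
  have hδ' : ((1 : ℕ) : Cardinal.{u}) < δ.cof :=
    by simpa using Ordinal.one_lt_cof_iff.2 hδ
  choose J hJ hpJ using fun k : Fin n =>
    hs.local_character hδ hM hMF (p.coord k k.2) (hs.coord_mem_bs hp k k.2) hδ'
  obtain ⟨j, hj, -, hJj⟩ := exists_lt_forall_le hδ.bot_lt hJ
  have hjδ := hM.1 j δ hj.le (Order.lt_succ δ)
  exact ⟨j, hj, hs.elongation_doesNotFork_of_coord hp (hMF j hj.le) hjδ fun k hk =>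
    hs.doesNotFork_base (hpJ ⟨k, hk⟩) (hM.1 _ _ (hJj _) (hj.trans (Order.lt_succ δ))) hjδ⟩

theorem elongation_continuity (hα : ((1 : ℕ) : ℕ∞) < α) {ℓ : Ordinal.{u} → ℕ}
    (hδ : Order.IsSuccLimit δ)
    (hM : IncreasingContinuous K.Prec (Order.succ δ) M) (hMF : ∀ i ≤ δ, K.InF lam th (M i))
    (hℓ : ∀ i j, i ≤ j → j ≤ δ → ℓ i ≤ ℓ j) (hlub : IsLUB (ℓ '' Set.Iio δ) (ℓ δ))
    (p : ∀ i, i < δ → GType K (M i) (ℓ i))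
    (hp : ∀ i hi, p i hi ∈ (s.elongation ⊤ lam th).bs (M i) (ℓ i))
    (hext : ∀ j i (hji : j < i) (hi : i < δ), (p i hi).Extends (p j (hji.trans hi))) :
    ∃ q ∈ (s.elongation ⊤ lam th).bs (M δ) (ℓ δ), (∀ i hi, q.Extends (p i hi)) ∧
      ((∀ i hi, (s.elongation ⊤ lam th).DoesNotFork (p i hi) (M 0)) →
        (s.elongation ⊤ lam th).DoesNotFork q (M 0)) := by
  have hprec : ∀ {i j}, i ≤ j → j ≤ δ → K.Prec (M i) (M j) := fun hij hj =>
    hM.1 _ _ hij (Order.lt_succ_of_le hj)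
  have hext' : ∀ j i (hji : j ≤ i) (hi : i < δ), (p i hi).Extends (p j (hji.trans_lt hi)) := by
    intro j i hji hi
    rcases hji.eq_or_lt with rfl | h
    · exact ⟨K.refl (hMF j hi.le).1, le_rfl, GType.restrict_refl _ _⟩
    · exact hext j i h hi
  -- A finite supremum of natural numbers is attained: otherwise `ℓ δ - 1` would be a smaller upper
  -- bound, where `ℓ δ` is positive because it exceeds `ℓ 0`.
  obtain ⟨i₀, hi₀, hℓi₀⟩ : ∃ i₀ < δ, ℓ i₀ = ℓ δ := by
    by_contra! hne
    have hlt : ∀ i < δ, ℓ i < ℓ δ := fun i hi => lt_of_le_of_ne (hℓ i δ hi.le le_rfl) (hne i hi)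
    have := hlub.2 (show ℓ δ - 1 ∈ upperBounds (ℓ '' Set.Iio δ) by
      rintro _ ⟨i, hi, rfl⟩
      have := hlt i hi
      omega)
    have := hlt 0 hδ.bot_lt
    omega
  have hℓeq : ∀ i, i₀ ≤ i → i ≤ δ → ℓ i = ℓ δ := fun i hi hi' =>
    le_antisymm (hℓ i δ hi' le_rfl) (hℓi₀ ▸ hℓ i₀ i hi hi')
  have hmax : ∀ {i}, i < δ → max i i₀ < δ := fun hi => max_lt hi hi₀
  -- For each entry, length-one continuity gives a limit type, and local character gives an index
  -- over which that limit does not fork. The chain is made constant below `i₀`, so that the entry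
  -- exists at every index.
  have hcoord : ∀ k : Fin (ℓ δ), ∃ j < δ, i₀ ≤ j ∧ ∀ i (hi : i < δ) (hij : j ≤ i) (hk : ↑k < ℓ i),
      s.DoesNotFork ((p i hi).coord k hk) (M j) := by
    intro k
    have hk : ∀ i, i < δ → (k : ℕ) < ℓ (max i i₀) := fun i hi => by
      rw [hℓeq _ (le_max_right _ _) (hmax hi).le]
      exact k.2
    have hM' := hM.max_const hi₀
    have hMF' : ∀ i ≤ δ, K.InF lam th (M (max i i₀)) := fun i hi => hMF _ (max_le hi hi₀.le)
    obtain ⟨q, hq, hqp, -⟩ := hs.continuity (ℓ := fun _ => 1) hδ hM' hMF' (fun _ _ => hα)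
      (fun _ _ _ _ => le_rfl)
      (fun i _ hi => by
        rw [Set.Nonempty.image_const ⟨0, hi.bot_lt⟩]
        exact isLUB_singleton)
      (fun i hi => (p (max i i₀) (hmax hi)).coord k (hk i hi))
      (fun i hi => hs.coord_mem_bs (hp _ _) _ _)
      (fun j i hji hi => (hext' _ _ (max_le_max_right i₀ hji.le) (hmax hi)).coord _ _ _)
    obtain ⟨j, hj, hqj⟩ := hs.local_character hδ hM' hMF' q hq
      (by simpa using Ordinal.one_lt_cof_iff.2 hδ)
    refine ⟨max j i₀, hmax hj, le_max_right _ _, ?_⟩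
    -- The index `i'` is kept separate from `max i i₀`, since the types of `p` at equal indices are
    -- not definitionally the same.
    have key : ∀ i (hi : i < δ), max j i₀ ≤ i → ∀ i' (hi' : i' < δ) (hk' : ↑k < ℓ i'),
        max i i₀ = i' → s.DoesNotFork ((p i' hi').coord k hk') (M (max j i₀)) := by
      rintro i hi hji _ hi' hk' rfl
      obtain ⟨h, _, hqi⟩ := hqp i hi
      have := hs.doesNotFork_restrict hqj (hprec (hji.trans (le_max_left _ _)) hi'.le) h le_rfl
      rwa [hqi] at this
    exact fun i hi hij hk => key i hi hij i hi hk (max_eq_left ((le_max_right _ _).trans hij))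
  choose J hJ _ hJp using hcoord
  obtain ⟨j, hj, hi₀j, hJj⟩ := exists_lt_forall_le hi₀ hJ
  have hdnf : ∀ i (hi : i < δ), j ≤ i →
      (s.elongation ⊤ lam th).DoesNotFork (p i hi) (M j) := fun i hi hji =>
    hs.elongation_doesNotFork_of_coord (hp i hi) (hMF j hj.le) (hprec hji hi.le) fun k hk => by
      have hk' : k < ℓ δ := hk.trans_le (hℓ i δ hi.le le_rfl)
      exact hs.doesNotFork_base (hJp ⟨k, hk'⟩ i hi ((hJj _).trans hji) hk)
        (hprec (hJj _) hj.le) (hprec hji hi.le)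
  have ht := hs.isPreFrame_elongation
  -- From here on the limits of single entries are no longer used: the nonforking extension of `p j`
  -- is the candidate, and uniqueness over `M j` shows that it extends the later types.
  obtain ⟨q, hq, hqj, hqp⟩ := hs.elongation_existence (hp j hj) (hprec hj.le le_rfl)
    (hMF δ le_rfl) (hℓ j δ hj.le le_rfl)
  refine ⟨q, hq, fun i hi => ?_, fun h₀ => ?_⟩
  · have hi' : max i j < δ := max_lt hi hj
    have hji : j ≤ max i j := le_max_right _ _
    -- The lengths at `j` and at `max i j` are equal only propositionally, hence the version of
    -- uniqueness with `k = l`.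
    have huniq : ∀ {k l : ℕ} (hkl : k = l) (r r' : GType K (M (max i j)) l),
        (s.elongation ⊤ lam th).DoesNotFork r (M j) →
        (s.elongation ⊤ lam th).DoesNotFork r' (M j) →
        r.restrict (hprec hji hi'.le) hkl.le = r'.restrict (hprec hji hi'.le) hkl.le → r = r' := by
      rintro k _ rfl r r' hr hr' hrr'
      exact hs.elongation_uniqueness r r' _ hr hr' hrr'
    refine GType.Extends.trans (q := p (max i j) hi') ⟨hprec hi'.le le_rfl,
      hℓ _ δ hi'.le le_rfl, ?_⟩ (hext' _ _ (le_max_left _ _) hi')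
    refine huniq ((hℓeq j hi₀j hj.le).trans (hℓeq _ (hi₀j.trans hji) hi'.le).symm) _ _
      (ht.doesNotFork_restrict hqj (hprec hji hi'.le) _ _) (hdnf _ hi' hji) ?_
    obtain ⟨_, _, h₁⟩ := hqp
    obtain ⟨_, _, h₂⟩ := hext' j _ hji hi'
    rw [GType.restrict_restrict, h₁, h₂]
  · obtain ⟨h, hm, hqp⟩ := hqp
    have hcast : ∀ {k l : ℕ} (hkl : k = l) (r : GType K (M δ) l),
        (s.elongation ⊤ lam th).DoesNotFork (r.restrict h hkl.le) (M 0) →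
        (s.elongation ⊤ lam th).DoesNotFork (r.restrict h le_rfl) (M 0) := by
      rintro k _ rfl r hr
      exact hr
    refine hs.elongation_transitivity q (hprec zero_le hj.le) h hqj
      (hcast (hℓeq j hi₀j hj.le) q ?_)
    rw [hqp]
    exact h₀ j hj

theorem elongation (hα : ((1 : ℕ) : ℕ∞) < α) :
    IsGoodExceptStability ⊤ lam th (s.elongation ⊤ lam th) where
  toIsPreFrame := hs.isPreFrame_elongation
  amalgamation := hs.amalgamation
  joint_embedding := hs.joint_embedding
  no_maximal_models := hs.no_maximal_models
  density hM hN hMN hne := by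
    obtain ⟨a, ha, h, h', hbs⟩ := hs.density hM hN hMN hne
    exact ⟨a, ha, h, h', hs.elongation_bs_one ▸ hbs⟩
  existence p hp hMN hN hmk _ := hs.elongation_existence hp hMN hN hmk
  uniqueness p q h _ hp hq hpq := hs.elongation_uniqueness p q h hp hq hpq
  symmetry h _ ha hbs := hs.elongation_symmetry h ha hbs
  local_character hδ hM hMF p hp _ := hs.elongation_local_character hδ hM hMF hp
  continuity hδ hM hMF _ hℓ hlub p hp hext :=
    hs.elongation_continuity hα hδ hM hMF hℓ (hlub _ le_rfl hδ) p hp hext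
  transitivity p h₀₁ h _ hp hp' := hs.elongation_transitivity p h₀₁ h hp hp'

end IsGoodExceptStability

end

end GoodFrame

/-- Let `𝓕 = [lam, th)`. A good `𝓕`-frame is a good `(<2, 𝓕)`-frame (a frame for sequences of
length at most one); its elongation to finite tuples is a good `(<ω, 𝓕)`-frame, and likewise for
frames that are good except possibly for bs-stability. -/
theorem corollary4p6 {L : FirstOrder.Language.{u, u}} (K : GoodFrame.AEC L) (lam : Cardinal.{u})
    (th : WithTop Cardinal.{u}) (s : GoodFrame.FrameTriple K) :
    (GoodFrame.IsGood 2 lam th s → GoodFrame.IsGood ⊤ lam th (s.elongation ⊤ lam th)) ∧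
      (GoodFrame.IsGoodExceptStability 2 lam th s →
        GoodFrame.IsGoodExceptStability ⊤ lam th (s.elongation ⊤ lam th)) := by
  have hα : ((1 : ℕ) : ℕ∞) < 2 := by norm_num
  refine ⟨fun hs => ⟨hs.elongation hα, fun hM => ?_⟩, fun hs => hs.elongation hα⟩
  -- Stability counts types of length one only, and those are the basic types of `s`.
  rw [hs.elongation_bs_one]
  exact hs.bs_stability hM
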